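/- Let $F$ be a germ at $0\in\mathbb{C}^2$ of a holomorphic diffeomorphism with $F(0)=0$. Let $\Gamma$ be an irreducible formal curve, that is, a principal ideal of $\mathbb{C}[[x,y]]$ generated by an irreducible series $f$ (in particular $f\neq 0$ and $f(0)=0$), and suppose that $\Gamma$ is invariant by $F$, i.e. $h\circ F\in\Gamma$ for every $h\in\Gamma$. A parametrization of $\Gamma$ is a nonzero pair $\gamma(s)\in\mathbb{C}[[s]]^2$ with $\gamma(0)=0$ such that $h\in\Gamma$ if and only if $h(\gamma(s))=0$; it is irreducible if it cannot be written as $\sigma(\tau(s))$ with $\sigma$ a parametrization of $\Gamma$ and $\tau\in s^2\mathbb{C}[[s]]$. For an irreducible parametrization $\gamma$ there is $\theta\in\mathbb{C}[[s]]$ with $\theta(0)=0$, $\theta'(0)\neq0$ and $F\circ\gamma=\gamma\circ\theta$. Suppose that $\Gamma$ is hyperbolic, i.e. $|\theta'(0)|\neq1$, and singular, i.e. the order $\nu$ of $f$ is not $1$. Let $\lambda$ be the eigenvalue of $DF(0)$ on the tangent line of $\Gamma$, which is the zero set of the homogeneous component of degree $\nu$ of $f$. Then there exist coprime natural numbers $q>p>1$,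 a number $\mu\in\mathbb{C}$ with $\lambda^q=\mu^p$, and a germ of a holomorphic diffeomorphism $\Phi$ of $(\mathbb{C}^2,0)$ such that, in the analytic coordinates $\Phi$, the diffeomorphism $F$ is linear and diagonal and $\Gamma$ is the curve $y^p=x^q$; that is, as germs at $0$, $$\Phi\circ F=L\circ\Phi,\qquad L(x,y)=(\lambda x,\mu y),$$ and, for every $h\in\mathbb{C}[[x,y]]$, $h$ belongs to the ideal $(y^p-x^q)$ if and only if $h\circ\Phi\in\Gamma$. -/

import Mathlib

open Filter Topology

namespace PlanarCurve

noncomputable section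

/-- The ring `ℂ[[x, y]]`; `x` is the variable of index `0` and `y` the variable of index `1`. -/
abbrev Series2 : Type := MvPowerSeries (Fin 2) ℂ

/-- `F` represents a germ of a holomorphic diffeomorphism of `ℂ²` fixing the origin:
it is holomorphic near `0`, maps `0` to `0`, and has a holomorphic inverse germ. -/
def IsGermDiffeo (F : (Fin 2 → ℂ) → (Fin 2 → ℂ)) : Prop :=
  AnalyticAt ℂ F 0 ∧ F 0 = 0 ∧
    ∃ G : (Fin 2 → ℂ) → (Fin 2 → ℂ), AnalyticAt ℂ G 0 ∧ G 0 = 0 ∧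
      (∀ᶠ z in 𝓝 0, G (F z) = z) ∧ (∀ᶠ z in 𝓝 0, F (G z) = z)

/-- The Taylor series at the origin of a function of two complex variables: the coefficient of
`x ^ i * y ^ j` is `(∂ₓ ^ i ∂ᵧ ^ j f)(0) / (i! * j!)`. -/
def taylorSeries (f : (Fin 2 → ℂ) → ℂ) : Series2 := fun m =>
  iteratedDeriv (m 0) (fun x : ℂ => iteratedDeriv (m 1) (fun y : ℂ => f ![x, y]) 0) 0 /
    (((m 0).factorial : ℂ) * ((m 1).factorial : ℂ))

/-- The two components of a map germ as formal power series. -/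
def taylorMap (F : (Fin 2 → ℂ) → (Fin 2 → ℂ)) : Fin 2 → Series2 :=
  fun i => taylorSeries (fun z => F z i)

/-- The formal composition `h ∘ F` of a formal series `h` with a map germ `F` fixing `0`. -/
def compGerm (h : Series2) (F : (Fin 2 → ℂ) → (Fin 2 → ℂ)) : Series2 :=
  MvPowerSeries.subst (taylorMap F) h

/-- An (irreducible) formal curve: a principal ideal of `ℂ[[x, y]]` generated by an
irreducible (in particular nonzero and non-unit) series. -/
def IsFormalCurve (Γ : Ideal Series2) : Prop :=
  ∃ f : Series2, Irreducible f ∧ Γ = Ideal.span {f}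

/-- The multiplicity of a formal curve: the least order of its elements, which is
the order of any of its generators. -/
def curveMultiplicity (Γ : Ideal Series2) : ℕ∞ := ⨅ h ∈ Γ, MvPowerSeries.order h

/-- A formal curve is singular when its multiplicity is not `1`. -/
def IsSingular (Γ : Ideal Series2) : Prop := curveMultiplicity Γ ≠ 1

/-- The value at `v` of the homogeneous component of degree `n` of `h`. -/
def homogeneousPartAt (n : ℕ) (h : Series2) (v : Fin 2 → ℂ) : ℂ :=
  ∑ m ∈ (Finset.univ : Finset (Fin 2)).finsuppAntidiag n,
    MvPowerSeries.coeff m h * ∏ i, v i ^ m i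

/-- The tangent line of a formal curve `Γ` of multiplicity `ν`: the common zeros of the
homogeneous components of degree `ν` of the elements of `Γ`. Such a component is a constant
multiple of the initial form `(a x + b y) ^ ν` of a generator of `Γ`. -/
def tangentLine (Γ : Ideal Series2) : Set (Fin 2 → ℂ) :=
  {v | ∀ h ∈ Γ, homogeneousPartAt (curveMultiplicity Γ).toNat h v = 0}

/-- `c` is the tangent eigenvalue of `Γ`: the eigenvalue of `DF(0)` on the tangent line. -/
def IsTangentEigenvalue (F : (Fin 2 → ℂ) → (Fin 2 → ℂ)) (Γ : Ideal Series2) (c : ℂ) : Prop :=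
  (∃ v ∈ tangentLine Γ, v ≠ 0) ∧ ∀ v ∈ tangentLine Γ, fderiv ℂ F 0 v = c • v

/-- `Γ` is invariant by `F`: `h ∘ F ∈ Γ` for every `h ∈ Γ`. -/
def IsInvariant (F : (Fin 2 → ℂ) → (Fin 2 → ℂ)) (Γ : Ideal Series2) : Prop :=
  ∀ h ∈ Γ, compGerm h F ∈ Γ

/-- A parametrization of `Γ`: a nonzero pair `γ` of series in one variable with `γ(0) = 0`
such that `h ∈ Γ` if and only if `h(γ(s)) = 0`. -/
structure IsParametrization (Γ : Ideal Series2) (γ : Fin 2 → PowerSeries ℂ) : Prop where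
  ne_zero : γ ≠ 0
  constantCoeff_eq_zero : ∀ i, PowerSeries.constantCoeff (γ i) = 0
  mem_iff : ∀ h : Series2, h ∈ Γ ↔ MvPowerSeries.subst γ h = 0

/-- An irreducible parametrization: one that does not factor as `σ(τ(s))` through another
parametrization `σ` with `τ` of order greater than one. -/
structure IsIrreducibleParametrization (Γ : Ideal Series2) (γ : Fin 2 → PowerSeries ℂ) : Prop
    extends IsParametrization Γ γ where
  irreducible : ∀ (σ : Fin 2 → PowerSeries ℂ) (τ : PowerSeries ℂ), IsParametrization Γ σ →
    PowerSeries.constantCoeff τ = 0 → (∀ i, γ i = PowerSeries.subst τ (σ i)) →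
    PowerSeries.coeff 1 τ ≠ 0

/-- `θ` represents the restriction of `F` to `Γ`: it is a formal diffeomorphism in one variable
with `F(γ(s)) = γ(θ(s))` for some irreducible parametrization `γ` of `Γ`. -/
def IsRestriction (F : (Fin 2 → ℂ) → (Fin 2 → ℂ)) (Γ : Ideal Series2)
    (θ : PowerSeries ℂ) : Prop :=
  PowerSeries.constantCoeff θ = 0 ∧ PowerSeries.coeff 1 θ ≠ 0 ∧
    ∃ γ : Fin 2 → PowerSeries ℂ, IsIrreducibleParametrization Γ γ ∧
      ∀ i, MvPowerSeries.subst γ (taylorMap F i) = PowerSeries.subst θ (γ i)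

/-- `Γ` is a hyperbolic curve of `F`: the inner eigenvalue, that is the derivative at `0` of
the restriction of `F` to `Γ`, does not have modulus one. -/
def IsHyperbolic (F : (Fin 2 → ℂ) → (Fin 2 → ℂ)) (Γ : Ideal Series2) : Prop :=
  ∃ θ : PowerSeries ℂ, IsRestriction F Γ θ ∧ ‖PowerSeries.coeff 1 θ‖ ≠ 1

/-- The ideal of `ℂ[[x, y]]` of the curve `y ^ p = x ^ q`. -/
def cusp (p q : ℕ) : Ideal Series2 :=
  Ideal.span {MvPowerSeries.X 1 ^ p - MvPowerSeries.X 0 ^ q}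

end

end PlanarCurve

/-! Let `a` be the multiplier of the restriction `θ` of `F` to `Γ`, and `γ` an irreducible
parametrization. After a possible exchange of the coordinates, `γ 0` has the smallest order `n`.
Subtracting a series in `γ 0` from `γ 1` removes every exponent divisible by `n`; what remains is
nonzero because `Γ` is singular, and its order `m` satisfies `n < m` and `n ∤ m`. Comparing leading
terms in `F ∘ γ = γ ∘ θ` shows that `DF(0)` has the eigenvalues `a ^ n` and `a ^ m`
(`exists_eigenvectors`).

As `|a| ≠ 1`, both eigenvalues lie on the same side of the unit circle and distinct powers of `a`
are distinct, so a resonance would be an equation between exponents. The relation `n ∤ m` excludes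
it (`not_resonant_of_not_dvd`). Poincaré's theorem (`exists_linearization`) then gives a convergent
linearizing chart `Φ`. It is proved by solving for formal eigenfunctions of composition with `F` and
bounding them in a weighted `ℓ¹` norm.

Along `γ` the components of `Φ` are eigenfunctions of composition with `θ`, with eigenvalues `a ^ n`
and `a ^ m`. If `φ` linearizes `θ` formally, they must be multiples of `φ ^ n` and `φ ^ m`
(`eq_smul_pow_of_subst_eq_smul`). The constants are nonzero, again by singularity, and are scaled to
`1`. Hence `Φ ∘ γ = (φ ^ n, φ ^ m)`: irreducibility of `γ` makes `n` and `m` coprime, and `Γ`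
corresponds to the ideal of series vanishing on `(s ^ n, s ^ m)`, which is that of `y ^ n = x ^ m`
(`mem_cusp_iff`). So `p = n` and `q = m`; the tangent eigenvalue is read off in the chart. -/

namespace PlanarCurve

open MvPowerSeries
open scoped ENNReal NNReal

/-! ### Weighted `ℓ¹` norms of power series, and evaluation. -/

section WeightedNorm

variable {σ τ : Type*}

/-- The weighted `ℓ¹` norm `∑ |c_m| r ^ |m|` of a formal power series. -/
noncomputable def wnorm (r : ℝ≥0∞) (c : MvPowerSeries σ ℂ) : ℝ≥0∞ :=
  ∑' m, ‖coeff m c‖ₑ * r ^ m.degree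

theorem wnorm_le_of_forall_enorm_le {r : ℝ≥0∞} {c d : MvPowerSeries σ ℂ}
    (h : ∀ m, ‖coeff m c‖ₑ ≤ ‖coeff m d‖ₑ) : wnorm r c ≤ wnorm r d :=
  ENNReal.tsum_le_tsum fun m => by gcongr; exact h m

theorem wnorm_add_le (r : ℝ≥0∞) (c d : MvPowerSeries σ ℂ) :
    wnorm r (c + d) ≤ wnorm r c + wnorm r d := by
  unfold wnorm
  rw [← ENNReal.tsum_add]
  refine ENNReal.tsum_le_tsum fun m => ?_
  rw [← add_mul, map_add]
  gcongr
  exact enorm_add_le _ _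

theorem wnorm_smul (r : ℝ≥0∞) (a : ℂ) (c : MvPowerSeries σ ℂ) :
    wnorm r (a • c) = ‖a‖ₑ * wnorm r c := by
  unfold wnorm
  rw [← ENNReal.tsum_mul_left]
  simp [enorm_mul, mul_assoc]

theorem wnorm_sub_le (r : ℝ≥0∞) (c d : MvPowerSeries σ ℂ) :
    wnorm r (c - d) ≤ wnorm r c + wnorm r d := by
  have := wnorm_add_le r c (-d)
  have h : wnorm r (-d) = wnorm r d := by simp [wnorm]
  rwa [h, ← sub_eq_add_neg] at this

theorem wnorm_one (r : ℝ≥0∞) : wnorm r (1 : MvPowerSeries σ ℂ) = 1 := by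
  classical
  unfold wnorm
  rw [tsum_eq_single 0]
  · simp
  · intro m hm
    simp [coeff_one, hm]

theorem wnorm_mul_le (r : ℝ≥0∞) (c d : MvPowerSeries σ ℂ) :
    wnorm r (c * d) ≤ wnorm r c * wnorm r d := by
  classical
  calc wnorm r (c * d) ≤ ∑' m, ∑ p ∈ Finset.HasAntidiagonal.antidiagonal m,
        (‖coeff p.1 c‖ₑ * r ^ p.1.degree) * (‖coeff p.2 d‖ₑ * r ^ p.2.degree) := by
        refine ENNReal.tsum_le_tsum fun m => ?_
        rw [coeff_mul]
        calc _ ≤ (∑ p ∈ Finset.HasAntidiagonal.antidiagonal m, ‖coeff p.1 c * coeff p.2 d‖ₑ) * r ^ m.degree := by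
              gcongr; exact enorm_sum_le _ _
          _ = _ := by
              rw [Finset.sum_mul]
              refine Finset.sum_congr rfl fun p hp => ?_
              rw [← Finset.HasAntidiagonal.mem_antidiagonal.1 hp, map_add, pow_add, enorm_mul]
              ring
    _ = ∑' p : (σ →₀ ℕ) × (σ →₀ ℕ),
        (‖coeff p.1 c‖ₑ * r ^ p.1.degree) * (‖coeff p.2 d‖ₑ * r ^ p.2.degree) := by
        rw [← Finset.HasAntidiagonal.sigmaAntidiagonalEquivProd.tsum_eq, ENNReal.tsum_sigma']
        refine tsum_congr fun m => ?_
        rw [tsum_fintype, ← Finset.sum_finset_coe]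
        rfl
    _ = wnorm r c * wnorm r d := by
        rw [ENNReal.tsum_prod (f := fun a b => (‖coeff a c‖ₑ * r ^ a.degree) *
          (‖coeff b d‖ₑ * r ^ b.degree))]
        simp only [ENNReal.tsum_mul_left, ENNReal.tsum_mul_right]
        rfl

theorem wnorm_pow_le (r : ℝ≥0∞) (c : MvPowerSeries σ ℂ) (n : ℕ) :
    wnorm r (c ^ n) ≤ wnorm r c ^ n := by
  induction n with
  | zero => simp [wnorm_one]
  | succ n ih =>
    rw [pow_succ, pow_succ]
    exact (wnorm_mul_le _ _ _).trans (by gcongr)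

theorem wnorm_prod_le {r s : ℝ≥0∞} {G : σ → MvPowerSeries τ ℂ} (h : ∀ i, wnorm r (G i) ≤ s)
    (d : σ →₀ ℕ) : wnorm r (d.prod fun i e => G i ^ e) ≤ s ^ d.degree := by
  classical
  have key : ∀ t : Finset σ, wnorm r (∏ i ∈ t, G i ^ d i) ≤ ∏ i ∈ t, s ^ d i := by
    intro t
    induction t using Finset.induction_on with
    | empty => simp [wnorm_one]
    | insert a t ha ih =>
      rw [Finset.prod_insert ha, Finset.prod_insert ha]
      refine (wnorm_mul_le _ _ _).trans ?_
      gcongr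
      exact (wnorm_pow_le _ _ _).trans (by gcongr; exact h a)
  refine (key d.support).trans ?_
  rw [Finset.prod_pow_eq_pow_sum]
  rfl

/-- Submultiplicativity bounds each monomial in `G` of degree `k` by `s ^ k`; all terms are
nonnegative, so the sums can be exchanged. This is the formal version of `G` mapping the polydisc of
radius `r` into that of radius `s`. -/
theorem wnorm_subst_le {r s : ℝ≥0∞} {G : σ → MvPowerSeries τ ℂ} (hG : HasSubst G)
    (h : ∀ i, wnorm r (G i) ≤ s) (c : MvPowerSeries σ ℂ) :
    wnorm r (subst G c) ≤ wnorm s c := by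
  calc wnorm r (subst G c)
      ≤ ∑' m, ∑' d, ‖coeff d c‖ₑ *
          (‖coeff m (d.prod fun i e => G i ^ e)‖ₑ * r ^ m.degree) := by
        refine ENNReal.tsum_le_tsum fun m => ?_
        rw [coeff_subst hG, ← tsum_eq_finsum (L := .unconditional _) (coeff_subst_finite hG c m)]
        calc _ ≤ (∑' d, ‖coeff d c • coeff m (d.prod fun i e => G i ^ e)‖ₑ) * r ^ m.degree := by
              gcongr; exact enorm_tsum_le_tsum_enorm
          _ = _ := by
              rw [← ENNReal.tsum_mul_right]
              simp only [smul_eq_mul, enorm_mul, mul_assoc]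
    _ = ∑' d, ‖coeff d c‖ₑ * wnorm r (d.prod fun i e => G i ^ e) := by
        rw [ENNReal.tsum_comm]
        simp only [ENNReal.tsum_mul_left, wnorm]
    _ ≤ wnorm s c := ENNReal.tsum_le_tsum fun d => by
        gcongr
        exact wnorm_prod_le h d

/-- A Schwarz lemma: high order of vanishing turns a smaller radius into a small factor. It is the
source of the contraction in the convergence proof. -/
theorem wnorm_mul_radius_le {t : ℝ≥0∞} (ht : t ≤ 1) (r : ℝ≥0∞) {N : ℕ} {c : MvPowerSeries σ ℂ}
    (hc : ∀ m, m.degree < N → coeff m c = 0) : wnorm (t * r) c ≤ t ^ N * wnorm r c := by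
  unfold wnorm
  rw [← ENNReal.tsum_mul_left]
  refine ENNReal.tsum_le_tsum fun m => ?_
  by_cases hm : m.degree < N
  · simp [hc m hm]
  · rw [mul_pow, mul_left_comm]
    gcongr ?_ * _
    exact pow_le_pow_of_le_one (by positivity) ht (not_lt.1 hm)

/-- The value at `z` of a formal power series. -/
noncomputable def evalSeries (c : MvPowerSeries σ ℂ) (z : σ → ℂ) : ℂ :=
  ∑' m, coeff m c * m.prod fun i k => z i ^ k

theorem enorm_prod_pow_le {r : ℝ≥0∞} {z : σ → ℂ} (hz : ∀ i, ‖z i‖ₑ ≤ r) (m : σ →₀ ℕ) :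
    ‖m.prod fun i k => z i ^ k‖ₑ ≤ r ^ m.degree := by
  have h : ‖m.prod fun i k => z i ^ k‖ₑ = ∏ i ∈ m.support, ‖z i‖ₑ ^ m i := by
    simp only [enorm_eq_nnnorm, Finsupp.prod, nnnorm_prod, nnnorm_pow]
    push_cast; rfl
  rw [h]
  calc _ ≤ ∏ i ∈ m.support, r ^ m i := Finset.prod_le_prod' fun i _ => by gcongr; exact hz i
    _ = _ := by rw [Finset.prod_pow_eq_pow_sum]; rfl

theorem summable_of_tsum_enorm_ne_top {ι : Type*} {f : ι → ℂ} (h : ∑' i, ‖f i‖ₑ ≠ ⊤) :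
    Summable fun i => ‖f i‖ := by
  simp only [enorm_eq_nnnorm] at h
  simpa using NNReal.summable_coe.2 (ENNReal.tsum_coe_ne_top_iff_summable.1 h)

theorem tsum_enorm_eval_le {r : ℝ≥0∞} {z : σ → ℂ} (hz : ∀ i, ‖z i‖ₑ ≤ r)
    (c : MvPowerSeries σ ℂ) :
    ∑' m, ‖coeff m c * m.prod fun i k => z i ^ k‖ₑ ≤ wnorm r c := by
  refine ENNReal.tsum_le_tsum fun m => ?_
  rw [enorm_mul]
  gcongr
  exact enorm_prod_pow_le hz m

variable {r : ℝ≥0∞} {z : σ → ℂ}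

theorem summable_norm_eval (hz : ∀ i, ‖z i‖ₑ ≤ r) {c : MvPowerSeries σ ℂ} (hc : wnorm r c ≠ ⊤) :
    Summable fun m => ‖coeff m c * m.prod fun i k => z i ^ k‖ :=
  summable_of_tsum_enorm_ne_top (ne_top_of_le_ne_top hc (tsum_enorm_eval_le hz c))

theorem hasSum_evalSeries (hz : ∀ i, ‖z i‖ₑ ≤ r) {c : MvPowerSeries σ ℂ} (hc : wnorm r c ≠ ⊤) :
    HasSum (fun m => coeff m c * m.prod fun i k => z i ^ k) (evalSeries c z) :=
  (summable_norm_eval hz hc).of_norm.hasSum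

theorem evalSeries_one (z : σ → ℂ) : evalSeries 1 z = 1 := by
  classical
  unfold evalSeries
  rw [tsum_eq_single 0]
  · simp
  · intro m hm
    simp [coeff_one, hm]

theorem evalSeries_smul (a : ℂ) (c : MvPowerSeries σ ℂ) (z : σ → ℂ) :
    evalSeries (a • c) z = a * evalSeries c z := by
  simp only [evalSeries, ← tsum_mul_left, coeff_smul, mul_assoc]

theorem tsum_mul_tsum_eq_tsum_sum_antidiagonal' {A : Type*} [AddCommMonoid A]
    [Finset.HasAntidiagonal A] {f g : A → ℂ} (hf : Summable fun i => ‖f i‖)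
    (hg : Summable fun i => ‖g i‖) :
    (∑' n, f n) * ∑' n, g n =
      ∑' n, ∑ p ∈ Finset.HasAntidiagonal.antidiagonal n, f p.1 * g p.2 :=
  hf.of_norm.tsum_mul_tsum_eq_tsum_sum_antidiagonal hg.of_norm (summable_mul_of_summable_norm hf hg)

theorem evalSeries_mul (hz : ∀ i, ‖z i‖ₑ ≤ r) {c d : MvPowerSeries σ ℂ} (hc : wnorm r c ≠ ⊤)
    (hd : wnorm r d ≠ ⊤) : evalSeries (c * d) z = evalSeries c z * evalSeries d z := by
  classical
  have h := tsum_mul_tsum_eq_tsum_sum_antidiagonal' (summable_norm_eval hz hc)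
    (summable_norm_eval hz hd)
  unfold evalSeries
  rw [h]
  refine tsum_congr fun m => ?_
  rw [coeff_mul, Finset.sum_mul]
  refine Finset.sum_congr rfl fun p hp => ?_
  have h5 : (m.prod fun i k => z i ^ k) =
      (p.1.prod fun i k => z i ^ k) * p.2.prod fun i k => z i ^ k := by
    rw [← Finset.HasAntidiagonal.mem_antidiagonal.1 hp,
      Finsupp.prod_add_index' (fun _ => pow_zero _) (fun _ _ _ => pow_add _ _ _)]
  rw [h5, mul_mul_mul_comm]

theorem evalSeries_pow (hz : ∀ i, ‖z i‖ₑ ≤ r) {c : MvPowerSeries σ ℂ} (hc : wnorm r c ≠ ⊤)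
    (n : ℕ) : evalSeries (c ^ n) z = evalSeries c z ^ n := by
  induction n with
  | zero => simp [evalSeries_one]
  | succ n ih =>
    rw [pow_succ, pow_succ, evalSeries_mul hz _ hc, ih]
    exact ne_top_of_le_ne_top (ENNReal.pow_ne_top hc) (wnorm_pow_le r c n)

theorem evalSeries_prod (hz : ∀ i, ‖z i‖ₑ ≤ r) {ι : Type*} {G : ι → MvPowerSeries σ ℂ}
    (hG : ∀ i, wnorm r (G i) ≠ ⊤) (d : ι →₀ ℕ) :
    evalSeries (d.prod fun i e => G i ^ e) z = d.prod fun i e => evalSeries (G i) z ^ e := by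
  classical
  have key : ∀ t : Finset ι, wnorm r (∏ i ∈ t, G i ^ d i) ≠ ⊤ ∧
      evalSeries (∏ i ∈ t, G i ^ d i) z = ∏ i ∈ t, evalSeries (G i) z ^ d i := by
    intro t
    induction t using Finset.induction_on with
    | empty => simp [wnorm_one, evalSeries_one]
    | insert a t ha ih =>
      have h1 : wnorm r (G a ^ d a) ≠ ⊤ :=
        ne_top_of_le_ne_top (ENNReal.pow_ne_top (hG a)) (wnorm_pow_le _ _ _)
      rw [Finset.prod_insert ha, Finset.prod_insert ha, evalSeries_mul hz h1 ih.1, ih.2,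
        evalSeries_pow hz (hG a)]
      exact ⟨ne_top_of_le_ne_top (ENNReal.mul_ne_top h1 ih.1) (wnorm_mul_le _ _ _), rfl⟩
  exact (key d.support).2

theorem evalSeries_subst {s : ℝ≥0∞} (hz : ∀ i, ‖z i‖ₑ ≤ r) {ι : Type*} {G : ι → MvPowerSeries σ ℂ}
    (hG : HasSubst G) (hs : s ≠ ⊤) (h : ∀ i, wnorm r (G i) ≤ s) {c : MvPowerSeries ι ℂ}
    (hc : wnorm s c ≠ ⊤) :
    evalSeries (subst G c) z = evalSeries c fun i => evalSeries (G i) z := by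
  -- Absolute summability of the double family, dominated by `wnorm s c`, justifies expanding the
  -- composition in either order.
  have hsum : Summable (Function.uncurry fun (m : σ →₀ ℕ) (d : ι →₀ ℕ) =>
      coeff d c * (coeff m (d.prod fun i e => G i ^ e) * m.prod fun i k => z i ^ k)) := by
    refine (summable_of_tsum_enorm_ne_top (ne_top_of_le_ne_top hc ?_)).of_norm
    rw [ENNReal.tsum_prod', ENNReal.tsum_comm]
    refine ENNReal.tsum_le_tsum fun d => ?_
    simp only [Function.uncurry, enorm_mul (coeff d c), ENNReal.tsum_mul_left]
    gcongr
    exact (tsum_enorm_eval_le hz _).trans (wnorm_prod_le h d)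
  have hG' : ∀ i, wnorm r (G i) ≠ ⊤ := fun i => ne_top_of_le_ne_top hs (h i)
  calc evalSeries (subst G c) z
      = ∑' m, ∑' d, coeff d c * (coeff m (d.prod fun i e => G i ^ e) *
          m.prod fun i k => z i ^ k) := by
        refine tsum_congr fun m => ?_
        rw [coeff_subst hG, ← tsum_eq_finsum (L := .unconditional _) (coeff_subst_finite hG c m), ← tsum_mul_right]
        simp only [smul_eq_mul, mul_assoc]
    _ = ∑' d, ∑' m, coeff d c * (coeff m (d.prod fun i e => G i ^ e) *
          m.prod fun i k => z i ^ k) := hsum.tsum_comm.symm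
    _ = _ := by
        refine tsum_congr fun d => ?_
        rw [tsum_mul_left, ← evalSeries_prod hz hG' d, evalSeries]

end WeightedNorm

/-! ### Uniqueness of the Taylor expansion in two variables. -/

section Analytic

/-- A formal power series is convergent if some weighted `ℓ¹` norm of it is finite. -/
def IsConvergent {σ : Type*} (c : MvPowerSeries σ ℂ) : Prop :=
  ∃ r : ℝ≥0, 0 < r ∧ wnorm r c ≠ ⊤

theorem eventually_enorm_le {σ : Type*} [Finite σ] {r : ℝ≥0} (hr : 0 < r) :
    ∀ᶠ z : σ → ℂ in 𝓝 0, ∀ i, ‖z i‖ₑ ≤ r := by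
  refine eventually_all.2 fun i => ?_
  have h : Tendsto (fun z : σ → ℂ => ‖z i‖) (𝓝 0) (𝓝 0) := by
    have : Continuous fun z : σ → ℂ => ‖z i‖ := by fun_prop
    simpa using this.tendsto 0
  filter_upwards [h.eventually (gt_mem_nhds (show (0 : ℝ) < r from hr))] with z hz
  rw [enorm_le_coe]
  exact_mod_cast hz.le

/-- Exponents of monomials in two variables as pairs of natural numbers. -/
noncomputable def pairEquiv : ℕ × ℕ ≃ (Fin 2 →₀ ℕ) :=
  (finTwoArrowEquiv ℕ).symm.trans Finsupp.equivFunOnFinite.symm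

@[simp] theorem pairEquiv_apply_zero (p : ℕ × ℕ) : pairEquiv p 0 = p.1 := rfl

@[simp] theorem pairEquiv_apply_one (p : ℕ × ℕ) : pairEquiv p 1 = p.2 := rfl

theorem eq_pairEquiv (m : Fin 2 →₀ ℕ) : m = pairEquiv (m 0, m 1) := by
  ext i; fin_cases i <;> rfl

theorem degree_fin_two (m : Fin 2 →₀ ℕ) : m.degree = m 0 + m 1 := by
  rw [Finsupp.degree_eq_sum, Fin.sum_univ_two]

theorem prod_pow_fin_two {R : Type*} [CommMonoid R] (m : Fin 2 →₀ ℕ) (z : Fin 2 → R) :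
    (m.prod fun i k => z i ^ k) = z 0 ^ m 0 * z 1 ^ m 1 := by
  rw [Finsupp.prod_fintype _ _ fun _ => pow_zero _, Fin.prod_univ_two]

theorem iteratedDeriv_of_hasSum {g : ℂ → ℂ} {a : ℕ → ℂ}
    (h : ∀ᶠ t in 𝓝 0, HasSum (fun n => t ^ n * a n) (g t)) (n : ℕ) :
    iteratedDeriv n g 0 = n.factorial * a n := by
  have h1 : HasFPowerSeriesAt g (FormalMultilinearSeries.ofScalars ℂ a) 0 := by
    rw [hasFPowerSeriesAt_iff]
    simpa using h
  have h2 := congr_arg (FormalMultilinearSeries.coeff · n)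
    (h1.eq_formalMultilinearSeries h1.analyticAt.hasFPowerSeriesAt)
  simp only [FormalMultilinearSeries.coeff_ofScalars] at h2
  rw [h2, mul_div_cancel₀ _ (by exact_mod_cast n.factorial_ne_zero)]

theorem eventually_vec {P : (Fin 2 → ℂ) → Prop} (h : ∀ᶠ z in 𝓝 0, P z) :
    ∀ᶠ x : ℂ in 𝓝 0, ∀ᶠ y : ℂ in 𝓝 0, P ![x, y] := by
  have h1 : Tendsto (fun p : ℂ × ℂ => ![p.1, p.2]) (𝓝 (0, 0)) (𝓝 0) := by
    have : Continuous fun p : ℂ × ℂ => ![p.1, p.2] := by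
      refine continuous_pi fun i => ?_
      fin_cases i
      · exact continuous_fst
      · exact continuous_snd
    have h2 := this.tendsto (0, 0)
    have h3 : ![(0 : ℂ), 0] = 0 := by ext i; fin_cases i <;> rfl
    rwa [h3] at h2
  have h2 := h1.eventually h
  rw [nhds_prod_eq] at h2
  exact h2.curry

theorem taylorSeries_eq_of_eventuallyEq {f : (Fin 2 → ℂ) → ℂ} {c : Series2} (hc : IsConvergent c)
    (h : f =ᶠ[𝓝 0] evalSeries c) : taylorSeries f = c := by
  obtain ⟨r, hr, hc⟩ := hc
  have key : ∀ᶠ x : ℂ in 𝓝 0, ∀ᶠ y : ℂ in 𝓝 0,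
      HasSum (fun p : ℕ × ℕ => coeff (pairEquiv p) c * (x ^ p.1 * y ^ p.2)) (f ![x, y]) := by
    refine eventually_vec (P := fun z => HasSum (fun p : ℕ × ℕ => coeff (pairEquiv p) c *
      (z 0 ^ p.1 * z 1 ^ p.2)) (f z)) ?_
    filter_upwards [h, eventually_enorm_le hr] with z hz1 hz2
    rw [hz1]
    have := pairEquiv.hasSum_iff.2 (hasSum_evalSeries hz2 hc)
    simpa only [Function.comp_def, prod_pow_fin_two, pairEquiv_apply_zero,
      pairEquiv_apply_one] using this
  -- The iterated derivatives are taken one variable at a time, so the coefficient of each `y ^ b`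
  -- must itself be a convergent series in `x`. The family of exponents with fixed `b` is one row of
  -- the sum `wnorm r c`, up to the factor `r ^ b`.
  have hx : ∀ᶠ x : ℂ in 𝓝 0, ∀ b, HasSum (fun a => x ^ a * coeff (pairEquiv (a, b)) c)
      (∑' a, x ^ a * coeff (pairEquiv (a, b)) c) := by
    have : ∀ᶠ x : ℂ in 𝓝 0, ‖x‖ₑ ≤ r := by
      have := (continuous_norm (E := ℂ)).tendsto 0
      rw [norm_zero] at this
      filter_upwards [this.eventually (gt_mem_nhds (show (0 : ℝ) < r from hr))] with x hx
      rw [enorm_le_coe]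
      exact_mod_cast hx.le
    filter_upwards [this] with x hx b
    refine (Summable.of_norm (summable_of_tsum_enorm_ne_top
      (f := fun a => x ^ a * coeff (pairEquiv (a, b)) c) ?_)).hasSum
    have hrb : (r : ℝ≥0∞) ^ b ≠ 0 := pow_ne_zero _ (by exact_mod_cast hr.ne')
    have h1 : (∑' a, ‖x ^ a * coeff (pairEquiv (a, b)) c‖ₑ) * (r : ℝ≥0∞) ^ b ≤ wnorm r c := by
      rw [← ENNReal.tsum_mul_right]
      have hinj : Function.Injective fun a : ℕ => pairEquiv (a, b) := fun a a' h => by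
        simpa using pairEquiv.injective h
      refine le_trans (ENNReal.tsum_le_tsum fun a => ?_) (ENNReal.tsum_comp_le_tsum_of_injective hinj
        fun m => ‖coeff m c‖ₑ * r ^ m.degree)
      rw [enorm_mul, enorm_pow, degree_fin_two, pairEquiv_apply_zero, pairEquiv_apply_one, pow_add,
        mul_comm (‖x‖ₑ ^ a), mul_assoc]
      gcongr
    intro htop
    rw [htop, ENNReal.top_mul hrb] at h1
    exact hc (top_le_iff.1 h1)
  have hb : ∀ b : ℕ, (fun x : ℂ => iteratedDeriv b (fun y : ℂ => f ![x, y]) 0) =ᶠ[𝓝 0]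
      fun x => b.factorial * ∑' a, x ^ a * coeff (pairEquiv (a, b)) c := by
    intro b
    filter_upwards [key, hx] with x hx1 hx2
    refine iteratedDeriv_of_hasSum (a := fun b => ∑' a, x ^ a * coeff (pairEquiv (a, b)) c) ?_ b
    filter_upwards [hx1] with y hy
    have h1 := (Equiv.prodComm ℕ ℕ).hasSum_iff.2 hy
    refine h1.prod_fiberwise fun b => ?_
    simpa [mul_comm, mul_left_comm, mul_assoc] using (hx2 b).mul_left (y ^ b)
  ext m
  have h1 : iteratedDeriv (m 0) (fun x : ℂ => iteratedDeriv (m 1) (fun y : ℂ => f ![x, y]) 0) 0 =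
      (m 0).factorial * ((m 1).factorial * coeff (pairEquiv (m 0, m 1)) c) := by
    rw [(hb (m 1)).iteratedDeriv_eq]
    refine iteratedDeriv_of_hasSum
      (a := fun a => (m 1).factorial * coeff (pairEquiv (a, m 1)) c) ?_ (m 0)
    filter_upwards [hx] with x hx
    simpa [mul_left_comm] using (hx (m 1)).mul_left ((m 1).factorial : ℂ)
  change iteratedDeriv (m 0) (fun x : ℂ => iteratedDeriv (m 1) (fun y : ℂ => f ![x, y]) 0) 0 /
    (((m 0).factorial : ℂ) * ((m 1).factorial : ℂ)) = _
  rw [h1, ← eq_pairEquiv, ← mul_assoc, mul_div_cancel_left₀ _ (mul_ne_zero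
    (by exact_mod_cast (m 0).factorial_ne_zero) (by exact_mod_cast (m 1).factorial_ne_zero))]

end Analytic

/-! ### Analytic germs on `ℂ²` and convergent series. -/

section AnalyticExpansion

/-- The monomial `x ^ a * y ^ (n - a)` as a multilinear form in `n` variables. -/
noncomputable def monomialForm (n a : ℕ) :
    ContinuousMultilinearMap ℂ (fun _ : Fin n => Fin 2 → ℂ) ℂ :=
  (ContinuousMultilinearMap.mkPiAlgebraFin ℂ n ℂ).compContinuousLinearMap
    fun i => ContinuousLinearMap.proj (if i.1 < a then 0 else 1)

theorem norm_monomialForm_le (n a : ℕ) : ‖monomialForm n a‖ ≤ 1 := by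
  refine ContinuousMultilinearMap.opNorm_le_bound zero_le_one fun m => ?_
  simp only [monomialForm, ContinuousMultilinearMap.compContinuousLinearMap_apply,
    ContinuousMultilinearMap.mkPiAlgebraFin_apply, List.prod_ofFn, norm_prod, one_mul]
  exact Finset.prod_le_prod (fun _ _ => norm_nonneg _) fun i _ => norm_le_pi_norm (m i) _

theorem monomialForm_apply (a b : ℕ) (z : Fin 2 → ℂ) :
    monomialForm (a + b) a (fun _ => z) = z 0 ^ a * z 1 ^ b := by
  simp only [monomialForm, ContinuousMultilinearMap.compContinuousLinearMap_apply,
    ContinuousMultilinearMap.mkPiAlgebraFin_apply, List.prod_ofFn]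
  rw [Fin.prod_univ_add]
  simp

theorem analyticAt_evalSeries {c : Series2} (hc : IsConvergent c) :
    AnalyticAt ℂ (evalSeries c) 0 := by
  obtain ⟨r, hr, hc⟩ := hc
  -- Grouping the monomials by total degree; the forms need not be symmetric, as only their diagonal
  -- values count.
  let p : FormalMultilinearSeries ℂ (Fin 2 → ℂ) ℂ := fun n =>
    ∑ q ∈ Finset.HasAntidiagonal.antidiagonal n, coeff (pairEquiv q) c • monomialForm n q.1
  have hsum : ∑' q : ℕ × ℕ, ‖coeff (pairEquiv q) c‖ₑ * (r : ℝ≥0∞) ^ (q.1 + q.2) = wnorm r c := by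
    rw [wnorm, ← pairEquiv.tsum_eq]
    simp only [degree_fin_two, pairEquiv_apply_zero, pairEquiv_apply_one]
  have hrad : (r : ℝ≥0∞) ≤ p.radius := by
    refine p.le_radius_of_bound_nnreal (wnorm r c).toNNReal fun n => ?_
    rw [← ENNReal.coe_le_coe, ENNReal.coe_toNNReal hc]
    calc ((‖p n‖₊ * r ^ n : ℝ≥0) : ℝ≥0∞)
        ≤ ∑ q ∈ Finset.HasAntidiagonal.antidiagonal n,
          ‖coeff (pairEquiv q) c‖ₑ * (r : ℝ≥0∞) ^ (q.1 + q.2) := by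
          push_cast
          rw [← enorm_eq_nnnorm]
          calc ‖p n‖ₑ * (r : ℝ≥0∞) ^ n ≤ (∑ q ∈ Finset.HasAntidiagonal.antidiagonal n,
                ‖coeff (pairEquiv q) c • monomialForm n q.1‖ₑ) * (r : ℝ≥0∞) ^ n := by
                gcongr; exact enorm_sum_le (Finset.HasAntidiagonal.antidiagonal n)
                  fun q => coeff (pairEquiv q) c • monomialForm n q.1
            _ ≤ _ := by
                rw [Finset.sum_mul]
                refine Finset.sum_le_sum fun q hq => ?_
                rw [Finset.HasAntidiagonal.mem_antidiagonal.1 hq, enorm_smul]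
                gcongr
                refine mul_le_of_le_one_right' ?_
                have := norm_monomialForm_le n q.1
                rw [enorm_eq_nnnorm]
                exact_mod_cast this
      _ ≤ wnorm r c := by rw [← hsum]; exact ENNReal.sum_le_tsum _
  refine ⟨p, r, hrad, by exact_mod_cast hr, fun {y} hy => ?_⟩
  rw [zero_add]
  have hy' : ∀ i, ‖y i‖ₑ ≤ r := by
    intro i
    rw [Metric.mem_eball, edist_zero_right] at hy
    rw [enorm_le_coe]
    have h1 : ‖y‖₊ < r := by exact_mod_cast hy
    exact (nnnorm_le_pi_nnnorm y i).trans h1.le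
  have h1 := pairEquiv.hasSum_iff.2 (hasSum_evalSeries hy' hc)
  have h2 := Finset.HasAntidiagonal.sigmaAntidiagonalEquivProd.hasSum_iff.2 h1
  refine h2.sigma fun n => ?_
  have h3 : p n (fun _ => y) = ∑ q : Finset.HasAntidiagonal.antidiagonal n,
      coeff (pairEquiv q) c * (y 0 ^ q.1.1 * y 1 ^ q.1.2) := by
    rw [Finset.sum_coe_sort (Finset.HasAntidiagonal.antidiagonal n)
      fun q : ℕ × ℕ => coeff (pairEquiv q) c * (y 0 ^ q.1 * y 1 ^ q.2)]
    simp only [p, sum_apply, smul_apply]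
    refine Finset.sum_congr rfl fun q hq => ?_
    rw [← Finset.HasAntidiagonal.mem_antidiagonal.1 hq, monomialForm_apply, smul_eq_mul]
  rw [h3]
  simp only [Function.comp_def, prod_pow_fin_two]
  exact hasSum_fintype _

/-- The coefficients of the expansion of a power series on `ℂ²` in monomials. -/
noncomputable def monomialCoeff (p : FormalMultilinearSeries ℂ (Fin 2 → ℂ) ℂ) : Series2 := fun m =>
  ∑ s ∈ Finset.powersetCard (m 0) (Finset.univ : Finset (Fin (m 0 + m 1))),
    p (m 0 + m 1) (s.piecewise (fun _ => Pi.single 0 1) fun _ => Pi.single 1 1)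

theorem coeff_monomialCoeff (p : FormalMultilinearSeries ℂ (Fin 2 → ℂ) ℂ) (a b : ℕ) :
    coeff (pairEquiv (a, b)) (monomialCoeff p) =
      ∑ s ∈ Finset.powersetCard a (Finset.univ : Finset (Fin (a + b))),
        p (a + b) (s.piecewise (fun _ => Pi.single 0 1) fun _ => Pi.single 1 1) := rfl

/-- Multilinear expansion of `p n` at `y = y 0 • e₀ + y 1 • e₁`: a subset `s` of the slots records
which of them receive `e₀`, and the subsets of size `a` contribute to `x ^ a * y ^ (n - a)`. -/
theorem sum_antidiagonal_monomialCoeff (p : FormalMultilinearSeries ℂ (Fin 2 → ℂ) ℂ) (n : ℕ)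
    (y : Fin 2 → ℂ) : ∑ q ∈ Finset.HasAntidiagonal.antidiagonal n,
      coeff (pairEquiv q) (monomialCoeff p) * (y 0 ^ q.1 * y 1 ^ q.2) = p n fun _ => y := by
  have hy : (fun _ : Fin n => y) = (fun _ => y 0 • Pi.single 0 1) + fun _ => y 1 • Pi.single 1 1 := by
    ext i j
    fin_cases j <;> simp
  rw [hy, ContinuousMultilinearMap.map_add_univ, ← Finset.powerset_univ, Finset.sum_powerset,
    Finset.card_univ, Fintype.card_fin, Finset.Nat.sum_antidiagonal_eq_sum_range_succ_mk]
  refine Finset.sum_congr rfl fun a ha => ?_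
  obtain ⟨b, rfl⟩ := Nat.exists_eq_add_of_le (Nat.lt_succ_iff.1 (Finset.mem_range.1 ha))
  rw [Nat.add_sub_cancel_left, coeff_monomialCoeff, Finset.sum_mul]
  refine Finset.sum_congr rfl fun s hs => ?_
  have hs' := (Finset.mem_powersetCard.1 hs).2
  have h1 : s.piecewise (fun _ : Fin (a + b) => y 0 • (Pi.single 0 1 : Fin 2 → ℂ))
      (fun _ => y 1 • Pi.single 1 1) = fun i => (s.piecewise (fun _ => y 0) (fun _ => y 1) i) •
      (s.piecewise (fun _ : Fin (a + b) => (Pi.single 0 1 : Fin 2 → ℂ)) fun _ => Pi.single 1 1) i := by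
    ext i
    by_cases hi : i ∈ s <;> simp [hi]
  rw [h1, ContinuousMultilinearMap.map_smul_univ, smul_eq_mul, mul_comm]
  congr 1
  rw [Finset.prod_piecewise]
  simp [hs', Finset.card_sdiff, Finset.inter_univ]

theorem enorm_coeff_monomialCoeff_le (p : FormalMultilinearSeries ℂ (Fin 2 → ℂ) ℂ) (a b : ℕ) :
    ‖coeff (pairEquiv (a, b)) (monomialCoeff p)‖ₑ ≤ (a + b).choose a * ‖p (a + b)‖ₑ := by
  rw [coeff_monomialCoeff]
  refine (enorm_sum_le _ _).trans ?_
  refine (Finset.sum_le_card_nsmul _ _ ‖p (a + b)‖ₑ fun s _ => ?_).trans ?_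
  · have h := (p (a + b)).le_opNorm
      (s.piecewise (fun _ => Pi.single 0 1) fun _ => Pi.single 1 1)
    have h1 : ∏ i, ‖s.piecewise (fun _ : Fin (a + b) => (Pi.single 0 1 : Fin 2 → ℂ))
        (fun _ => Pi.single 1 1) i‖ = 1 := by
      refine Finset.prod_eq_one fun i _ => ?_
      by_cases hi : i ∈ s <;> simp [hi, Pi.norm_single]
    rw [h1, mul_one] at h
    simp only [enorm_eq_nnnorm]
    exact_mod_cast h
  · simp

theorem exists_series_of_analyticAt {f : (Fin 2 → ℂ) → ℂ} (hf : AnalyticAt ℂ f 0) :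
    ∃ c : Series2, IsConvergent c ∧ f =ᶠ[𝓝 0] evalSeries c := by
  obtain ⟨p, R, hp⟩ := hf
  obtain ⟨r, hr0, hr⟩ := ENNReal.lt_iff_exists_nnreal_btwn.1 (hp.r_pos.trans_le hp.r_le)
  have hr0' : 0 < r := by exact_mod_cast hr0
  -- The coefficients of degree `n` cost binomial factors adding up to `2 ^ n`; halving the radius
  -- pays for them.
  have hconv : wnorm (r / 2 : ℝ≥0) (monomialCoeff p) ≠ ⊤ := by
    have hsum := p.summable_nnnorm_mul_pow hr
    refine ne_top_of_le_ne_top (ENNReal.tsum_coe_ne_top_iff_summable.2 hsum) ?_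
    rw [wnorm, ← pairEquiv.tsum_eq,
      ← Finset.HasAntidiagonal.sigmaAntidiagonalEquivProd.tsum_eq, ENNReal.tsum_sigma']
    refine ENNReal.tsum_le_tsum fun n => ?_
    rw [tsum_fintype]
    change ∑ q : Finset.HasAntidiagonal.antidiagonal n,
      ‖coeff (pairEquiv q) (monomialCoeff p)‖ₑ * _ ^ (pairEquiv q).degree ≤ _
    rw [Finset.sum_coe_sort (Finset.HasAntidiagonal.antidiagonal n) fun q : ℕ × ℕ =>
      ‖coeff (pairEquiv q) (monomialCoeff p)‖ₑ * ((r / 2 : ℝ≥0) : ℝ≥0∞) ^ (pairEquiv q).degree]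
    calc _ ≤ ∑ q ∈ Finset.HasAntidiagonal.antidiagonal n,
          (n.choose q.1 : ℝ≥0∞) * (‖p n‖ₑ * ((r / 2 : ℝ≥0) : ℝ≥0∞) ^ n) := by
          refine Finset.sum_le_sum fun q hq => ?_
          have hq' := Finset.HasAntidiagonal.mem_antidiagonal.1 hq
          rw [degree_fin_two, pairEquiv_apply_zero, pairEquiv_apply_one, ← mul_assoc, ← hq']
          gcongr
          exact enorm_coeff_monomialCoeff_le p q.1 q.2
      _ = _ := by
          rw [← Finset.sum_mul, Finset.Nat.sum_antidiagonal_eq_sum_range_succ_mk, ← Nat.cast_sum,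
            Nat.sum_range_choose, enorm_eq_nnnorm]
          norm_cast
          rw [div_pow, mul_left_comm]
          congr 1
          push_cast
          field_simp
  refine ⟨monomialCoeff p, ⟨r / 2, by positivity, hconv⟩, ?_⟩
  filter_upwards [eventually_enorm_le (σ := Fin 2) (half_pos hr0'),
    Metric.eball_mem_nhds (0 : Fin 2 → ℂ) hp.r_pos] with z hz1 hz2
  have h1 := pairEquiv.hasSum_iff.2 (hasSum_evalSeries hz1 hconv)
  have h2 := Finset.HasAntidiagonal.sigmaAntidiagonalEquivProd.hasSum_iff.2 h1
  have h3 := h2.sigma (g := fun n => p n fun _ => z) fun n => by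
    rw [← sum_antidiagonal_monomialCoeff, ← Finset.sum_coe_sort]
    simp only [Function.comp_def, prod_pow_fin_two]
    exact hasSum_fintype _
  have h4 := hp.hasSum hz2
  rw [zero_add] at h4
  exact h4.unique h3

end AnalyticExpansion

/-! ### Taylor series of germs, their composition, and the inverse function theorem. -/

section Taylor

theorem isConvergent_taylorSeries {f : (Fin 2 → ℂ) → ℂ} (hf : AnalyticAt ℂ f 0) :
    IsConvergent (taylorSeries f) := by
  obtain ⟨c, hc, h⟩ := exists_series_of_analyticAt hf
  rwa [taylorSeries_eq_of_eventuallyEq hc h]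

theorem eventuallyEq_evalSeries_taylorSeries {f : (Fin 2 → ℂ) → ℂ} (hf : AnalyticAt ℂ f 0) :
    f =ᶠ[𝓝 0] evalSeries (taylorSeries f) := by
  obtain ⟨c, hc, h⟩ := exists_series_of_analyticAt hf
  rwa [taylorSeries_eq_of_eventuallyEq hc h]

theorem taylorSeries_congr {f g : (Fin 2 → ℂ) → ℂ} (hg : AnalyticAt ℂ g 0) (h : f =ᶠ[𝓝 0] g) :
    taylorSeries f = taylorSeries g :=
  taylorSeries_eq_of_eventuallyEq (isConvergent_taylorSeries hg)
    (h.trans (eventuallyEq_evalSeries_taylorSeries hg))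

theorem taylorSeries_evalSeries {c : Series2} (hc : IsConvergent c) :
    taylorSeries (evalSeries c) = c :=
  taylorSeries_eq_of_eventuallyEq hc EventuallyEq.rfl

theorem constantCoeff_taylorSeries (f : (Fin 2 → ℂ) → ℂ) :
    constantCoeff (taylorSeries f) = f 0 := by
  have h : ![(0 : ℂ), 0] = 0 := by ext i; fin_cases i <;> rfl
  rw [← coeff_zero_eq_constantCoeff_apply]
  change iteratedDeriv 0 (fun x : ℂ => iteratedDeriv 0 (fun y : ℂ => f ![x, y]) 0) 0 / _ = _
  simp [h]

theorem coeff_taylorSeries (f : (Fin 2 → ℂ) → ℂ) (m : Fin 2 →₀ ℕ) : coeff m (taylorSeries f) =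
    iteratedDeriv (m 0) (fun x : ℂ => iteratedDeriv (m 1) (fun y : ℂ => f ![x, y]) 0) 0 /
      (((m 0).factorial : ℂ) * ((m 1).factorial : ℂ)) := rfl

theorem coeff_single_taylorSeries {f : (Fin 2 → ℂ) → ℂ} (hf : DifferentiableAt ℂ f 0)
    (i : Fin 2) : coeff (Finsupp.single i 1) (taylorSeries f) =
      fderiv ℂ f 0 (Pi.single i 1) := by
  have h : ![(0 : ℂ), 0] = 0 := by ext i; fin_cases i <;> rfl
  have key : ∀ i : Fin 2, HasDerivAt (fun x : ℂ => f (Pi.single i x))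
      (fderiv ℂ f 0 (Pi.single i 1)) 0 := by
    intro i
    have h1 : HasDerivAt (fun x : ℂ => (Pi.single i x : Fin 2 → ℂ)) (Pi.single i 1) 0 := by
      rw [hasDerivAt_pi]
      intro j
      by_cases hj : j = i
      · subst hj; simpa using hasDerivAt_id' (0 : ℂ)
      · simpa [hj] using hasDerivAt_const (0 : ℂ) (0 : ℂ)
    have h2 : HasFDerivAt f (fderiv ℂ f 0) (Pi.single i 0) := by
      rw [Pi.single_zero]; exact hf.hasFDerivAt
    exact h2.comp_hasDerivAt (0 : ℂ) h1
  rw [coeff_taylorSeries]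
  fin_cases i
  · have h1 : ∀ x : ℂ, ![x, 0] = Pi.single 0 x := fun x => by ext j; fin_cases j <;> simp
    simpa [h1] using (key 0).deriv
  · have h1 : ∀ x : ℂ, ![0, x] = Pi.single 1 x := fun x => by ext j; fin_cases j <;> simp
    simpa [h1] using (key 1).deriv

/-- Vanishing to order `N + 1` gives a bound by a constant times `r ^ (N + 1)`, and the spare factor
`r` is made small. The case `N = 0` gives small values for germs vanishing at `0`; `N = 1` controls
nonlinear remainders. -/
theorem exists_wnorm_le {σ : Type*} {c : MvPowerSeries σ ℂ} (hc : IsConvergent c) {N : ℕ}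
    (hN : ∀ m, m.degree < N + 1 → coeff m c = 0) {δ : ℝ≥0} (hδ : 0 < δ) :
    ∃ ε : ℝ≥0, 0 < ε ∧ ∀ r : ℝ≥0, r ≤ ε → wnorm r c ≤ (δ * r ^ N : ℝ≥0) := by
  obtain ⟨r₀, hr₀, hc⟩ := hc
  obtain ⟨W, hW⟩ : ∃ W : ℝ≥0, (W : ℝ≥0∞) = wnorm r₀ c := ⟨_, ENNReal.coe_toNNReal hc⟩
  -- The second bound makes `(r / r₀) ^ (N + 1) * W ≤ δ * r ^ N`; adding `1` to `W` avoids a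
  -- division by zero.
  refine ⟨min r₀ (δ * r₀ ^ (N + 1) / (W + 1)), lt_min hr₀ (by positivity), fun r hr => ?_⟩
  have h1 : r / r₀ ≤ 1 := div_le_one_of_le₀ (hr.trans (min_le_left _ _)) hr₀.le
  have h2 : r * (W + 1) ≤ δ * r₀ ^ (N + 1) :=
    (le_div_iff₀ (by positivity)).1 (hr.trans (min_le_right _ _))
  have h3 := wnorm_mul_radius_le (t := (r / r₀ : ℝ≥0)) (by exact_mod_cast h1) r₀ hN
  rw [← ENNReal.coe_mul, div_mul_cancel₀ _ hr₀.ne', ← hW] at h3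
  refine h3.trans ?_
  norm_cast
  rw [div_pow, div_mul_eq_mul_div, div_le_iff₀ (by positivity), pow_succ]
  calc r ^ N * r * W ≤ r ^ N * (r * (W + 1)) := by
        rw [mul_assoc]; gcongr; exact le_self_add
    _ ≤ r ^ N * (δ * r₀ ^ (N + 1)) := by gcongr
    _ = _ := by ring

theorem coeff_eq_zero_of_degree_lt_one {σ : Type*} {c : MvPowerSeries σ ℂ}
    (h : constantCoeff c = 0) (m : σ →₀ ℕ) (hm : m.degree < 0 + 1) : coeff m c = 0 := by
  have : m = 0 := (Finsupp.degree_eq_zero_iff m).1 (by omega)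
  rw [this, coeff_zero_eq_constantCoeff_apply, h]

theorem hasSubst_taylorMap {G : (Fin 2 → ℂ) → Fin 2 → ℂ} (h0 : G 0 = 0) :
    HasSubst (taylorMap G) :=
  hasSubst_of_constantCoeff_zero fun i => by
    rw [taylorMap, constantCoeff_taylorSeries, h0]; rfl

theorem analyticAt_component {G : (Fin 2 → ℂ) → Fin 2 → ℂ} (hG : AnalyticAt ℂ G 0) (i : Fin 2) :
    AnalyticAt ℂ (fun z => G z i) 0 :=
  (ContinuousLinearMap.proj (R := ℂ) (φ := fun _ : Fin 2 => ℂ) i).analyticAt _ |>.comp hG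

theorem exists_radius {ι σ : Type*} [Finite ι] {G : ι → MvPowerSeries σ ℂ}
    (hG : ∀ i, IsConvergent (G i)) (h0 : ∀ i, constantCoeff (G i) = 0) {s : ℝ≥0} (hs : 0 < s) :
    ∃ r : ℝ≥0, 0 < r ∧ ∀ i, wnorm r (G i) ≤ s := by
  choose ε hε h using fun i => exists_wnorm_le (hG i) (coeff_eq_zero_of_degree_lt_one (h0 i)) hs
  obtain ⟨r, hr, hr'⟩ : ∃ r : ℝ≥0, 0 < r ∧ ∀ i, r ≤ ε i := by
    cases isEmpty_or_nonempty ι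
    · exact ⟨1, one_pos, fun i => isEmptyElim i⟩
    · obtain ⟨i₀, hi₀⟩ := Finite.exists_min ε
      exact ⟨ε i₀, hε i₀, hi₀⟩
  exact ⟨r, hr, fun i => by simpa using h i r (hr' i)⟩

theorem isConvergent_subst {ι σ : Type*} [Finite ι] {G : ι → MvPowerSeries σ ℂ}
    (hG : ∀ i, IsConvergent (G i)) (h0 : ∀ i, constantCoeff (G i) = 0) {c : MvPowerSeries ι ℂ}
    (hc : IsConvergent c) : IsConvergent (subst G c) := by
  obtain ⟨s, hs, hc⟩ := hc
  obtain ⟨r, hr, h⟩ := exists_radius hG h0 hs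
  exact ⟨r, hr, ne_top_of_le_ne_top hc
    (wnorm_subst_le (hasSubst_of_constantCoeff_zero h0) h c)⟩

theorem evalSeries_subst_eventuallyEq {ι σ : Type*} [Finite ι] [Finite σ]
    {G : ι → MvPowerSeries σ ℂ} (hG : ∀ i, IsConvergent (G i))
    (h0 : ∀ i, constantCoeff (G i) = 0) {c : MvPowerSeries ι ℂ} (hc : IsConvergent c) :
    evalSeries (subst G c) =ᶠ[𝓝 0] fun z => evalSeries c fun i => evalSeries (G i) z := by
  obtain ⟨s, hs, hc⟩ := hc
  obtain ⟨r, hr, h⟩ := exists_radius hG h0 hs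
  filter_upwards [eventually_enorm_le hr] with z hz
  exact evalSeries_subst hz (hasSubst_of_constantCoeff_zero h0) ENNReal.coe_ne_top h hc

/-- The bridge from germs to formal series: the substituted series converges to the composed
function, and the expansion is unique. -/
theorem taylorSeries_comp {f : (Fin 2 → ℂ) → ℂ} {G : (Fin 2 → ℂ) → Fin 2 → ℂ}
    (hf : AnalyticAt ℂ f 0) (hG : AnalyticAt ℂ G 0) (h0 : G 0 = 0) :
    taylorSeries (fun z => f (G z)) = subst (taylorMap G) (taylorSeries f) := by
  have hGi := fun i => analyticAt_component hG i
  have hcG : ∀ i, IsConvergent (taylorMap G i) := fun i => isConvergent_taylorSeries (hGi i)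
  have h0G : ∀ i, constantCoeff (taylorMap G i) = 0 := fun i => by
    rw [taylorMap, constantCoeff_taylorSeries, h0]; rfl
  have hcf := isConvergent_taylorSeries hf
  refine taylorSeries_eq_of_eventuallyEq (isConvergent_subst hcG h0G hcf) ?_
  have ht : Tendsto G (𝓝 0) (𝓝 0) := by simpa [h0] using hG.continuousAt.tendsto
  have h1 : ∀ᶠ z in 𝓝 (0 : Fin 2 → ℂ), ∀ i, G z i = evalSeries (taylorMap G i) z :=
    eventually_all.2 fun i => eventuallyEq_evalSeries_taylorSeries (hGi i)
  filter_upwards [ht.eventually (eventuallyEq_evalSeries_taylorSeries hf), h1,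
    evalSeries_subst_eventuallyEq hcG h0G hcf] with z hz1 hz2 hz3
  rw [hz1, hz3]
  congr 1
  ext i
  exact hz2 i

theorem taylorMap_comp {F G : (Fin 2 → ℂ) → Fin 2 → ℂ} (hF : AnalyticAt ℂ F 0)
    (hG : AnalyticAt ℂ G 0) (h0 : G 0 = 0) (i : Fin 2) :
    taylorMap (fun z => F (G z)) i = subst (taylorMap G) (taylorMap F i) :=
  taylorSeries_comp (analyticAt_component hF i) hG h0

/-- In finite dimension an injective differential is invertible, so the analytic inverse function
theorem applies. -/
theorem isGermDiffeo_of_injective_fderiv {Φ : (Fin 2 → ℂ) → Fin 2 → ℂ} (h : AnalyticAt ℂ Φ 0)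
    (h0 : Φ 0 = 0) (hinj : ∀ v, fderiv ℂ Φ 0 v = 0 → v = 0) : IsGermDiffeo Φ := by
  let e : (Fin 2 → ℂ) ≃L[ℂ] (Fin 2 → ℂ) := (LinearEquiv.ofInjectiveEndo
    (fderiv ℂ Φ 0 : (Fin 2 → ℂ) →ₗ[ℂ] (Fin 2 → ℂ))
    ((injective_iff_map_eq_zero _).2 hinj)).toContinuousLinearEquiv
  have he : (e : (Fin 2 → ℂ) →L[ℂ] (Fin 2 → ℂ)) = fderiv ℂ Φ 0 := by ext1 v; rfl
  have hs : HasStrictFDerivAt Φ (e : (Fin 2 → ℂ) →L[ℂ] (Fin 2 → ℂ)) 0 := by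
    rw [he]; exact h.hasStrictFDerivAt
  let P := hs.toOpenPartialHomeomorph Φ
  have hP : (P : (Fin 2 → ℂ) → Fin 2 → ℂ) = Φ := hs.toOpenPartialHomeomorph_coe
  have hmem : (0 : Fin 2 → ℂ) ∈ P.source := hs.mem_toOpenPartialHomeomorph_source
  have hmem' : (0 : Fin 2 → ℂ) ∈ P.target := by
    have := P.map_source hmem
    rwa [hP, h0] at this
  have hsymm : P.symm 0 = 0 := by
    have := P.left_inv hmem
    rwa [hP, h0] at this
  refine ⟨h, h0, P.symm, ?_, hsymm, ?_, ?_⟩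
  · refine P.analyticAt_symm (i := e) hmem' ?_ ?_
    · rw [hsymm, hP]; exact h
    · rw [hsymm, hP, he]
  · filter_upwards [P.open_source.mem_nhds hmem] with z hz
    have := P.left_inv hz
    rwa [hP] at this
  · filter_upwards [P.open_target.mem_nhds hmem'] with z hz
    have := P.right_inv hz
    rwa [hP] at this

theorem IsGermDiffeo.tendsto {F : (Fin 2 → ℂ) → Fin 2 → ℂ} (hF : IsGermDiffeo F) :
    Tendsto F (𝓝 0) (𝓝 0) := by
  simpa [hF.2.1] using hF.1.continuousAt.tendsto

theorem IsGermDiffeo.injective_fderiv {F : (Fin 2 → ℂ) → Fin 2 → ℂ} (hF : IsGermDiffeo F)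
    {v : Fin 2 → ℂ} (hv : fderiv ℂ F 0 v = 0) : v = 0 := by
  obtain ⟨hF, h0, G, hG, hG0, h1, h2⟩ := hF
  have h3 : HasFDerivAt (fun z => G (F z)) ((fderiv ℂ G 0).comp (fderiv ℂ F 0)) 0 := by
    refine HasFDerivAt.comp (0 : Fin 2 → ℂ) ?_ hF.differentiableAt.hasFDerivAt
    rw [h0]; exact hG.differentiableAt.hasFDerivAt
  have h4 : HasFDerivAt (fun z => G (F z)) (ContinuousLinearMap.id ℂ (Fin 2 → ℂ)) 0 :=
    (hasFDerivAt_id _).congr_of_eventuallyEq h1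
  have h5 := congrArg (fun L => L v) (h3.unique h4)
  simpa [hv] using h5.symm

end Taylor

/-! ### Formal eigenfunctions of a composition operator and their convergence. -/

section FormalEigenfunction

/-- A self-map of a space of sequences that improves the agreement of two sequences by one degree
has a fixed point. -/
theorem exists_fixedPoint {ι R : Type*} [Inhabited R] (deg : ι → ℕ) (Ψ : (ι → R) → ι → R)
    (h : ∀ k φ ψ, (∀ i, deg i < k → φ i = ψ i) → ∀ i, deg i < k + 1 → Ψ φ i = Ψ ψ i) :
    ∃ φ, Ψ φ = φ := by
  let s : ℕ → ι → R := fun k => Ψ^[k] default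
  have hs : ∀ k, s (k + 1) = Ψ (s k) := fun k => Function.iterate_succ_apply' Ψ k _
  have h1 : ∀ k i, deg i < k → s k i = s (k + 1) i := by
    intro k
    induction k with
    | zero => simp
    | succ k ih =>
      intro i hi
      rw [hs k, hs (k + 1)]
      exact h k _ _ ih i hi
  have h2 : ∀ k n i, deg i < k → s (k + n) i = s k i := by
    intro k n i hi
    induction n with
    | zero => rfl
    | succ n ih => rw [← ih, ← add_assoc, h1 (k + n) i (by omega)]
  -- From the `k`-th iterate on, all entries of degree less than `k` are stationary; hence the shift
  -- by one.
  refine ⟨fun i => s (deg i + 1) i, ?_⟩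
  funext i
  rw [hs]
  refine h (deg i) _ _ (fun j hj => ?_) i (Nat.lt_succ_self _)
  obtain ⟨n, hn⟩ := Nat.exists_eq_add_of_lt hj
  rw [hn, show deg j + n + 1 = deg j + 1 + n by ring, h2 _ _ _ (Nat.lt_succ_self _)]

variable {σ τ : Type*}

theorem exists_series_fixedPoint (Ψ : MvPowerSeries σ ℂ → (σ →₀ ℕ) → ℂ)
    (h : ∀ k φ ψ, (∀ m, m.degree < k → coeff m φ = coeff m ψ) →
      ∀ m, m.degree < k + 1 → Ψ φ m = Ψ ψ m) :
    ∃ φ : MvPowerSeries σ ℂ, ∀ m, coeff m φ = Ψ φ m := by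
  obtain ⟨φ, hφ⟩ := exists_fixedPoint (R := ℂ) (fun m : σ →₀ ℕ => m.degree) Ψ h
  exact ⟨φ, fun m => (congrFun hφ m).symm⟩

theorem homogeneousComponent_prod {ι R : Type*} [CommSemiring R] (f : ι → MvPowerSeries σ R)
    (n : ι → ℕ) (s : Finset ι) (hf : ∀ i, (n i : ℕ∞) ≤ (f i).order) :
    ((∑ i ∈ s, n i : ℕ) : ℕ∞) ≤ (∏ i ∈ s, f i).order ∧
      homogeneousComponent (∑ i ∈ s, n i) (∏ i ∈ s, f i) =
        ∏ i ∈ s, homogeneousComponent (n i) (f i) := by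
  classical
  induction s using Finset.induction_on with
  | empty =>
    simp only [Finset.sum_empty, Finset.prod_empty, CharP.cast_eq_zero, zero_le, true_and]
    ext d
    rw [coeff_homogeneousComponent, coeff_one]
    by_cases hd : d = 0 <;> simp [hd, Finsupp.degree_eq_zero_iff]
  | insert a s ha ih =>
    rw [Finset.sum_insert ha, Finset.prod_insert ha, Finset.prod_insert ha]
    refine ⟨?_, ?_⟩
    · push_cast
      refine (add_le_add (hf a) ?_).trans le_order_mul
      exact_mod_cast ih.1
    · rw [homogeneousComponent_mul_of_le_order (hf a) ih.1, ih.2]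

theorem homogeneousComponent_pow {R : Type*} [CommSemiring R] (f : MvPowerSeries σ R) (n k : ℕ)
    (hf : (n : ℕ∞) ≤ f.order) : ((k * n : ℕ) : ℕ∞) ≤ (f ^ k).order ∧
      homogeneousComponent (k * n) (f ^ k) = homogeneousComponent n f ^ k := by
  simpa using homogeneousComponent_prod (fun _ : Fin k => f) (fun _ => n) Finset.univ fun _ => hf

/-- The series `f i` vanish at the origin and have linear parts `Λ i * X i`. -/
structure IsDiagonalToFirstOrder (f : σ → MvPowerSeries σ ℂ) (Λ : σ → ℂ) : Prop where
  order_sub : ∀ i m, m.degree < 2 → coeff m (f i) = coeff m (Λ i • (X i : MvPowerSeries σ ℂ))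

variable {f : σ → MvPowerSeries σ ℂ} {Λ : σ → ℂ}

theorem IsDiagonalToFirstOrder.constantCoeff (hf : IsDiagonalToFirstOrder f Λ) (i : σ) :
    constantCoeff (f i) = 0 := by
  rw [← coeff_zero_eq_constantCoeff_apply, hf.order_sub i 0 (by simp)]
  simp

theorem IsDiagonalToFirstOrder.hasSubst [Finite σ] (hf : IsDiagonalToFirstOrder f Λ) :
    HasSubst f :=
  hasSubst_of_constantCoeff_zero hf.constantCoeff

/-- The lowest homogeneous component of a product is the product of the lowest components, here a
multiple of the monomial `X ^ d`. -/
theorem IsDiagonalToFirstOrder.coeff_prod [DecidableEq σ] (hf : IsDiagonalToFirstOrder f Λ)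
    {m d : σ →₀ ℕ} (hmd : m.degree ≤ d.degree) :
    coeff m (d.prod fun i e => f i ^ e) = if m = d then d.prod fun i e => Λ i ^ e else 0 := by
  have h1 : ∀ i, ((1 : ℕ) : ℕ∞) ≤ (f i).order := fun i => by
    rw [Nat.cast_one]
    exact one_le_order_iff_constCoeff_eq_zero.2 (hf.constantCoeff i)
  have h2 : ∀ i, homogeneousComponent 1 (f i) = Λ i • (X i : MvPowerSeries σ ℂ) := by
    intro i
    ext m
    rw [coeff_homogeneousComponent]
    split_ifs with hm
    · exact hf.order_sub i m (by omega)
    · rw [coeff_smul, coeff_X, if_neg, mul_zero]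
      rintro rfl
      simp at hm
  have h3 := fun i => homogeneousComponent_pow (f i) 1 (d i) (h1 i)
  simp only [mul_one, h2] at h3
  obtain ⟨h4, h5⟩ := homogeneousComponent_prod (fun i => f i ^ d i) d d.support fun i => (h3 i).1
  have h6 : ∑ i ∈ d.support, d i = d.degree := rfl
  rw [h6] at h4 h5
  simp only [fun i => (h3 i).2] at h5
  rcases hmd.lt_or_eq with hlt | heq
  · rw [if_neg (by rintro rfl; exact hlt.ne rfl)]
    exact coeff_of_lt_order (lt_of_lt_of_le (by exact_mod_cast hlt) h4)
  · have h7 := congrArg (coeff m) h5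
    rw [coeff_homogeneousComponent, if_pos heq] at h7
    refine h7.trans ?_
    have h8 : ∏ i ∈ d.support, (Λ i • (X i : MvPowerSeries σ ℂ)) ^ d i =
        C (d.prod fun i e => Λ i ^ e) * ∏ i ∈ d.support, X i ^ d i := by
      simp only [Finsupp.prod, map_prod, ← Finset.prod_mul_distrib]
      refine Finset.prod_congr rfl fun i _ => ?_
      rw [smul_eq_C_mul, mul_pow, map_pow]
    have h9 : (∏ i ∈ d.support, X i ^ d i : MvPowerSeries σ ℂ) = monomial d 1 := by
      rw [monomial_one_eq]; rfl
    rw [h8, h9, coeff_C_mul, coeff_monomial]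
    split_ifs <;> simp

/-- Composition with `f` is triangular for the filtration by degree, with diagonal entries `Λ ^ m`.
Applied to a difference of two series, this says how the coefficients in degree `k` depend on the
terms of degree `k`. -/
theorem IsDiagonalToFirstOrder.coeff_subst [Finite σ] (hf : IsDiagonalToFirstOrder f Λ)
    {δ : MvPowerSeries σ ℂ} {k : ℕ} (hδ : ∀ d, d.degree < k → coeff d δ = 0) {m : σ →₀ ℕ}
    (hm : m.degree ≤ k) :
    coeff m (subst f δ) = (m.prod fun i e => Λ i ^ e) * coeff m δ := by
  classical
  rw [MvPowerSeries.coeff_subst hf.hasSubst, finsum_eq_single _ m]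
  · rw [hf.coeff_prod le_rfl, if_pos rfl, smul_eq_mul, mul_comm]
  · intro d hd
    by_cases hdk : d.degree < k
    · rw [hδ d hdk, zero_smul]
    · rw [hf.coeff_prod (hm.trans (not_lt.1 hdk)), if_neg hd.symm, smul_zero]

theorem exists_formal_eigenfunction [Finite σ] (hf : IsDiagonalToFirstOrder f Λ) (i : σ)
    (hres : ∀ m : σ →₀ ℕ, 2 ≤ m.degree → (m.prod fun j e => Λ j ^ e) ≠ Λ i) :
    ∃ φ : MvPowerSeries σ ℂ, (∀ m, m.degree < 2 → coeff m φ = coeff m (X i)) ∧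
      subst f φ = Λ i • φ := by
  classical
  -- The eigenvalue equation in degree `m` reads `(Λ i - Λ ^ m) φ_m = (subst f φ)_m - Λ ^ m φ_m`. By
  -- triangularity the right-hand side involves only coefficients of lower degree, and nonresonance
  -- permits the division.
  obtain ⟨φ, hφ⟩ := exists_series_fixedPoint
    (fun (φ : MvPowerSeries σ ℂ) m => if m.degree < 2 then coeff m (X i : MvPowerSeries σ ℂ) else
      (coeff m (subst f φ) - (m.prod fun j e => Λ j ^ e) * coeff m φ) /
        (Λ i - m.prod fun j e => Λ j ^ e)) (by
      intro k φ ψ h m hm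
      split_ifs with h2
      · rfl
      · congr 1
        have h3 := hf.coeff_subst (δ := φ - ψ) (k := k)
          (fun d hd => by rw [map_sub, sub_eq_zero]; exact h d hd) (m := m) (Nat.lt_succ_iff.1 hm)
        rw [subst_sub hf.hasSubst, map_sub, map_sub] at h3
        linear_combination h3)
  have h1 : ∀ m, m.degree < 2 → coeff m φ = coeff m (X i) := by
    intro m hm
    rw [hφ m, if_pos hm]
  refine ⟨φ, h1, ?_⟩
  ext m
  rw [coeff_smul]
  by_cases hm : m.degree < 2
  · rw [hf.coeff_subst (k := 1) (fun d hd => ?_) (Nat.lt_succ_iff.1 hm), h1 m hm, coeff_X]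
    · split_ifs with h
      · simp [h]
      · simp
    · rw [h1 d (by omega), coeff_X, if_neg]
      rintro rfl
      simp at hd
  · have := hφ m
    rw [if_neg hm, eq_div_iff (sub_ne_zero.2 (hres m (not_lt.1 hm)).symm)] at this
    linear_combination -this

theorem wnorm_coe_ne_top {r : ℝ≥0} (p : MvPolynomial σ ℂ) :
    wnorm r (p : MvPowerSeries σ ℂ) ≠ ⊤ := by
  rw [wnorm, tsum_eq_sum (s := p.support)]
  · exact ENNReal.sum_ne_top.2 fun m _ =>
      ENNReal.mul_ne_top enorm_ne_top (ENNReal.pow_ne_top ENNReal.coe_ne_top)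
  · intro m hm
    simp [MvPolynomial.notMem_support_iff.1 hm]

theorem wnorm_le_of_forall_truncTotal [Finite σ] {r B : ℝ≥0∞} {c : MvPowerSeries σ ℂ}
    (h : ∀ M, wnorm r (truncTotal M c : MvPowerSeries σ ℂ) ≤ B) : wnorm r c ≤ B := by
  rw [wnorm, ENNReal.tsum_eq_iSup_sum]
  refine iSup_le fun s => ?_
  obtain ⟨M, hM⟩ : ∃ M, ∀ m ∈ s, m.degree < M := by
    refine ⟨s.sup (fun m => m.degree) + 1, fun m hm => Nat.lt_succ_iff.2 ?_⟩
    exact Finset.le_sup (f := fun m : σ →₀ ℕ => m.degree) hm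
  refine le_trans ?_ (h M)
  refine le_trans (Finset.sum_le_sum fun m hm => ?_) (ENNReal.sum_le_tsum s)
  rw [MvPolynomial.coeff_coe, coeff_truncTotal _ (hM m hm)]

/-- The linear part contributes `‖Λ i‖ * r`, and for small `r` the remainder, of order two, fits in
the gap `(ρ - ‖Λ i‖) * r`. -/
theorem IsDiagonalToFirstOrder.exists_wnorm_le [Finite σ] (hf : IsDiagonalToFirstOrder f Λ)
    (hc : ∀ i, IsConvergent (f i)) {ρ : ℝ≥0} (hρ : ∀ i, ‖Λ i‖₊ < ρ) :
    ∃ r : ℝ≥0, 0 < r ∧ ∀ i, wnorm r (f i) ≤ (ρ * r : ℝ≥0) := by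
  classical
  have hX : ∀ i r, wnorm r (Λ i • (X i : MvPowerSeries σ ℂ)) ≤ ‖Λ i‖₊ * r := by
    intro i r
    rw [wnorm_smul, enorm_eq_nnnorm, wnorm, tsum_eq_single (Finsupp.single i 1)]
    · simp
    · intro m hm
      simp [coeff_X, hm]
  have hs : ∀ i, IsConvergent (f i - Λ i • (X i : MvPowerSeries σ ℂ)) := by
    intro i
    obtain ⟨r, hr, h⟩ := hc i
    refine ⟨r, hr, ne_top_of_le_ne_top (ENNReal.add_ne_top.2 ⟨h, ?_⟩) (wnorm_sub_le _ _ _)⟩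
    exact ne_top_of_le_ne_top (by finiteness) (hX i r)
  have hex : ∀ i, ∃ ε : ℝ≥0, 0 < ε ∧ ∀ r : ℝ≥0, r ≤ ε →
      wnorm r (f i - Λ i • (X i : MvPowerSeries σ ℂ)) ≤ ((ρ - ‖Λ i‖₊) * r ^ 1 : ℝ≥0) := fun i =>
    PlanarCurve.exists_wnorm_le (hs i)
      (fun m hm => by rw [map_sub, hf.order_sub i m (by omega), sub_self])
      (tsub_pos_of_lt (hρ i))
  choose ε hε h using hex
  obtain ⟨r, hr, hr'⟩ : ∃ r : ℝ≥0, 0 < r ∧ ∀ i, r ≤ ε i := by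
    cases isEmpty_or_nonempty σ
    · exact ⟨1, one_pos, fun i => isEmptyElim i⟩
    · obtain ⟨i₀, hi₀⟩ := Finite.exists_min ε
      exact ⟨ε i₀, hε i₀, hi₀⟩
  refine ⟨r, hr, fun i => ?_⟩
  have h1 := wnorm_add_le r (Λ i • (X i : MvPowerSeries σ ℂ)) (f i - Λ i • X i)
  rw [add_sub_cancel] at h1
  refine h1.trans ((add_le_add (hX i r) (h i r (hr' i))).trans ?_)
  norm_cast
  rw [pow_one, ← add_mul, add_tsub_cancel_of_le (hρ i).le]

/-- Since `f` contracts by `ρ`, composition with `f` has norm at most `ρ ^ N` on series of order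
`N`. Beyond a polynomial part, the equation `a R = R ∘ f + E` therefore bounds the tail `R` by the
convergent error `E` once `ρ ^ N` is below `‖a‖ / 2`. -/
theorem IsDiagonalToFirstOrder.isConvergent_of_subst_eq_smul [Finite σ]
    (hf : IsDiagonalToFirstOrder f Λ) (hc : ∀ i, IsConvergent (f i)) {ρ : ℝ≥0} (hρ1 : ρ < 1)
    (hρ : ∀ i, ‖Λ i‖₊ < ρ) {a : ℂ} (ha : a ≠ 0) {φ : MvPowerSeries σ ℂ}
    (hφ : subst f φ = a • φ) : IsConvergent φ := by
  obtain ⟨r, hr, hfr⟩ := hf.exists_wnorm_le hc hρ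
  obtain ⟨N, hN⟩ : ∃ N, ρ ^ N < ‖a‖₊ / 2 :=
    exists_pow_lt_of_lt_one (half_pos (nnnorm_pos.2 ha)) hρ1
  set P : MvPowerSeries σ ℂ := (truncTotal N φ : MvPowerSeries σ ℂ) with hP
  set R := φ - P with hR
  set E := subst f P - a • P with hE
  have hfr' : ∀ i, wnorm r (f i) ≤ r := fun i => (hfr i).trans (by
    rw [ENNReal.coe_le_coe]; exact mul_le_of_le_one_left' hρ1.le)
  have hEtop : wnorm r E ≠ ⊤ := by
    refine ne_top_of_le_ne_top (ENNReal.add_ne_top.2 ⟨?_, ?_⟩) (wnorm_sub_le _ _ _)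
    · exact ne_top_of_le_ne_top (wnorm_coe_ne_top _) (wnorm_subst_le hf.hasSubst hfr' _)
    · rw [wnorm_smul]
      exact ENNReal.mul_ne_top enorm_ne_top (wnorm_coe_ne_top _)
  have hRE : a • R = subst f R + E := by
    rw [hR, hE, subst_sub hf.hasSubst, hφ, smul_sub]
    ring
  have hRN : ∀ m, m.degree < N → coeff m R = 0 := by
    intro m hm
    rw [hR, map_sub, hP, MvPolynomial.coeff_coe, coeff_truncTotal _ hm, sub_self]
  -- The norm of `R` might be infinite, so it could not be absorbed into the left-hand side.
  -- Truncations have finite norm, and the bound does not depend on `M`.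
  have key : ∀ M, wnorm r (truncTotal M R : MvPowerSeries σ ℂ) ≤
      wnorm r E * ((‖a‖₊ / 2 : ℝ≥0) : ℝ≥0∞)⁻¹ := by
    intro M
    set Q : MvPowerSeries σ ℂ := (truncTotal M R : MvPowerSeries σ ℂ) with hQ
    have hQtop : wnorm r Q ≠ ⊤ := wnorm_coe_ne_top _
    have h1 : wnorm r (a • Q) ≤ wnorm r (subst f Q + E) := by
      refine wnorm_le_of_forall_enorm_le fun m => ?_
      by_cases hm : m.degree < M
      · refine le_of_eq (congrArg _ ?_)
        -- Below degree `M`, composition with `f` does not see the part of `R` cut off by the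
        -- truncation.
        have h2 : coeff m (subst f (R - Q)) = 0 := by
          rw [hf.coeff_subst (k := M) (fun d hd => ?_) hm.le, map_sub, hQ, MvPolynomial.coeff_coe,
            coeff_truncTotal _ hm, sub_self, mul_zero]
          rw [map_sub, hQ, MvPolynomial.coeff_coe, coeff_truncTotal _ hd, sub_self]
        have h3 := congrArg (coeff m) hRE
        rw [subst_sub hf.hasSubst, map_sub] at h2
        rw [coeff_smul, map_add] at h3
        rw [coeff_smul, map_add, hQ, MvPolynomial.coeff_coe, coeff_truncTotal _ hm, h3, ← hQ]
        linear_combination h2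
      · rw [coeff_smul, hQ, MvPolynomial.coeff_coe, coeff_truncTotal_eq_zero _ (not_lt.1 hm)]
        simp
    have h2 : wnorm r (subst f Q) ≤ (ρ : ℝ≥0∞) ^ N * wnorm r Q := by
      refine (wnorm_subst_le hf.hasSubst hfr Q).trans ?_
      rw [ENNReal.coe_mul]
      refine wnorm_mul_radius_le (by exact_mod_cast hρ1.le) r fun m hm => ?_
      rw [hQ, MvPolynomial.coeff_coe, coeff_truncTotal_eq_ite, hRN m hm, ite_self]
    have h3 := (h1.trans (wnorm_add_le _ _ _)).trans (add_le_add_left h2 (wnorm r E))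
    rw [wnorm_smul] at h3
    obtain ⟨q, hq⟩ : ∃ q : ℝ≥0, (q : ℝ≥0∞) = wnorm r Q := ⟨_, ENNReal.coe_toNNReal hQtop⟩
    obtain ⟨e, he⟩ : ∃ e : ℝ≥0, (e : ℝ≥0∞) = wnorm r E := ⟨_, ENNReal.coe_toNNReal hEtop⟩
    have ha2 : 0 < ‖a‖₊ / 2 := half_pos (nnnorm_pos.2 ha)
    rw [← hq, ← he, enorm_eq_nnnorm] at h3
    rw [← hq, ← he, ← ENNReal.coe_inv ha2.ne', ← ENNReal.coe_mul, ENNReal.coe_le_coe,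
      ← div_eq_mul_inv, le_div_iff₀ ha2]
    have h4 : ‖a‖₊ * q ≤ ρ ^ N * q + e := by exact_mod_cast h3
    have h5 : ‖a‖₊ * q ≤ ‖a‖₊ / 2 * q + e := h4.trans (by gcongr)
    have h6 : ‖a‖₊ * q = ‖a‖₊ / 2 * q + ‖a‖₊ / 2 * q := by rw [← add_mul, add_halves]
    rw [h6] at h5
    rw [mul_comm]
    exact le_of_add_le_add_left h5
  refine ⟨r, hr, ?_⟩
  have h1 : φ = P + R := by rw [hR]; ring
  rw [h1]
  refine ne_top_of_le_ne_top (ENNReal.add_ne_top.2 ⟨wnorm_coe_ne_top _, ?_⟩) (wnorm_add_le _ _ _)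
  refine ne_top_of_le_ne_top ?_ (wnorm_le_of_forall_truncTotal key)
  exact ENNReal.mul_ne_top hEtop (ENNReal.inv_ne_top.2
    (by exact_mod_cast (half_pos (nnnorm_pos.2 ha)).ne'))

end FormalEigenfunction

/-! ### Poincaré linearization in dimension two. -/

section Linearization

theorem eq_zero_or_single_of_degree_lt_two {σ : Type*} {m : σ →₀ ℕ} (hm : m.degree < 2) :
    m = 0 ∨ ∃ j, m = Finsupp.single j 1 := by
  have h : m.degree = 0 ∨ m.degree = 1 := by omega
  rcases h with h | h
  · exact Or.inl ((Finsupp.degree_eq_zero_iff m).1 h)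
  · right
    have h0 : m ≠ 0 := by rintro rfl; simp at h
    obtain ⟨j, hj⟩ := Finsupp.ne_iff.1 h0
    obtain ⟨k, hk⟩ := exists_add_of_le
      (show Finsupp.single j 1 ≤ m from Finsupp.single_le_iff.2 (Nat.one_le_iff_ne_zero.2 hj))
    have h2 : k.degree = 0 := by
      rw [hk, map_add, Finsupp.degree_single] at h
      omega
    rw [(Finsupp.degree_eq_zero_iff k).1 h2, add_zero] at hk
    exact ⟨j, hk⟩

theorem fderiv_apply_eq_sum {G : (Fin 2 → ℂ) → Fin 2 → ℂ} (hG : AnalyticAt ℂ G 0)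
    (v : Fin 2 → ℂ) (i : Fin 2) :
    fderiv ℂ G 0 v i = ∑ j, v j * coeff (Finsupp.single j 1) (taylorMap G i) := by
  have h1 : v = ∑ j, v j • (Pi.single j 1 : Fin 2 → ℂ) := by
    ext k; fin_cases k <;> simp [Fin.sum_univ_two]
  have h2 : ∀ u, fderiv ℂ (fun z => G z i) 0 u = fderiv ℂ G 0 u i := by
    intro u
    have := (hasFDerivAt_pi'.1 hG.differentiableAt.hasFDerivAt i).fderiv
    rw [this]; rfl
  conv_lhs => rw [h1]
  simp only [taylorMap, map_sum, map_smul, Finset.sum_apply, Pi.smul_apply, smul_eq_mul,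
    coeff_single_taylorSeries (analyticAt_component hG i).differentiableAt, h2]

/-- The two convergent eigenfunctions have linear parts `x` and `y`, so together they form a chart
tangent to the identity. -/
theorem exists_linearization_of_diagonal {F : (Fin 2 → ℂ) → Fin 2 → ℂ} (hF : AnalyticAt ℂ F 0)
    (h0 : F 0 = 0) {Λ : Fin 2 → ℂ}
    (hlin : ∀ i, fderiv ℂ F 0 (Pi.single i 1) = Λ i • Pi.single i 1) (hΛ0 : ∀ i, Λ i ≠ 0)
    (hΛ1 : ∀ i, ‖Λ i‖ < 1) (hres : ∀ i, ∀ m : Fin 2 →₀ ℕ, 2 ≤ m.degree →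
      (m.prod fun j e => Λ j ^ e) ≠ Λ i) :
    ∃ Φ : (Fin 2 → ℂ) → Fin 2 → ℂ, IsGermDiffeo Φ ∧
      ∀ᶠ z in 𝓝 0, ∀ i, Φ (F z) i = Λ i * Φ z i := by
  have hdiag : IsDiagonalToFirstOrder (taylorMap F) Λ := by
    refine ⟨fun i m hm => ?_⟩
    rcases eq_zero_or_single_of_degree_lt_two hm with rfl | ⟨j, rfl⟩
    · rw [coeff_zero_eq_constantCoeff_apply, taylorMap, constantCoeff_taylorSeries, h0]
      simp
    · have h := fderiv_apply_eq_sum hF (Pi.single j 1) i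
      rw [hlin j] at h
      have h2 : ∑ k, (Pi.single j 1 : Fin 2 → ℂ) k * coeff (Finsupp.single k 1) (taylorMap F i) =
          coeff (Finsupp.single j 1) (taylorMap F i) := by
        simp [Pi.single_apply]
      rw [← h2, ← h, coeff_smul, coeff_X]
      by_cases hij : j = i
      · subst hij; simp
      · simp [hij, Finsupp.single_left_inj]
  have hconv : ∀ i, IsConvergent (taylorMap F i) := fun i =>
    isConvergent_taylorSeries (analyticAt_component hF i)
  choose φ hφ1 hφ2 using fun i => exists_formal_eigenfunction hdiag i (hres i)
  obtain ⟨ρ, hρ, hρ1⟩ : ∃ ρ : ℝ≥0, (∀ i, ‖Λ i‖₊ < ρ) ∧ ρ < 1 := by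
    obtain ⟨i₀, hi₀⟩ := Finite.exists_max fun i => ‖Λ i‖₊
    obtain ⟨ρ, h1, h2⟩ := exists_between (show ‖Λ i₀‖₊ < 1 from hΛ1 i₀)
    exact ⟨ρ, fun i => (hi₀ i).trans_lt h1, h2⟩
  have hφc : ∀ i, IsConvergent (φ i) := fun i =>
    hdiag.isConvergent_of_subst_eq_smul hconv hρ1 hρ (hΛ0 i) (hφ2 i)
  let Φ : (Fin 2 → ℂ) → Fin 2 → ℂ := fun z i => evalSeries (φ i) z
  have hΦa : AnalyticAt ℂ Φ 0 := AnalyticAt.pi fun i => analyticAt_evalSeries (hφc i)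
  have hT : ∀ i, taylorMap Φ i = φ i := fun i => taylorSeries_evalSeries (hφc i)
  have hΦ0 : Φ 0 = 0 := by
    ext i
    rw [← constantCoeff_taylorSeries (fun z => Φ z i)]
    change constantCoeff (taylorMap Φ i) = 0
    rw [hT, ← coeff_zero_eq_constantCoeff_apply, hφ1 i 0 (by simp)]
    simp
  have hd : ∀ v, fderiv ℂ Φ 0 v = v := by
    intro v
    ext i
    rw [fderiv_apply_eq_sum hΦa]
    have h2 : ∀ j, coeff (Finsupp.single j 1) (taylorMap Φ i) = if j = i then 1 else 0 := by
      intro j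
      rw [hT, hφ1 i _ (by simp), coeff_X]
      simp [Finsupp.single_left_inj]
    simp [h2]
  refine ⟨Φ, isGermDiffeo_of_injective_fderiv hΦa hΦ0 fun v hv => by rwa [hd] at hv, ?_⟩
  refine eventually_all.2 fun i => ?_
  have h1 := evalSeries_subst_eventuallyEq hconv hdiag.constantCoeff (hφc i)
  have h2 : ∀ᶠ z in 𝓝 (0 : Fin 2 → ℂ), ∀ i, F z i = evalSeries (taylorMap F i) z :=
    eventually_all.2 fun i => eventuallyEq_evalSeries_taylorSeries (analyticAt_component hF i)
  filter_upwards [h1, h2] with z hz1 hz2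
  rw [hφ2 i, evalSeries_smul] at hz1
  rw [hz1]
  change evalSeries (φ i) (F z) = _
  congr 1
  ext j
  exact hz2 j

theorem exists_linearization_of_norm_lt_one {F : (Fin 2 → ℂ) → Fin 2 → ℂ}
    (hF : AnalyticAt ℂ F 0) (h0 : F 0 = 0) {Λ : Fin 2 → ℂ} {w : Fin 2 → Fin 2 → ℂ}
    (hw : LinearIndependent ℂ w) (hlin : ∀ i, fderiv ℂ F 0 (w i) = Λ i • w i)
    (hΛ0 : ∀ i, Λ i ≠ 0) (hΛ1 : ∀ i, ‖Λ i‖ < 1) (hres : ∀ i, ∀ m : Fin 2 →₀ ℕ, 2 ≤ m.degree →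
      (m.prod fun j e => Λ j ^ e) ≠ Λ i) :
    ∃ Φ : (Fin 2 → ℂ) → Fin 2 → ℂ, IsGermDiffeo Φ ∧
      ∀ᶠ z in 𝓝 0, ∀ i, Φ (F z) i = Λ i * Φ z i := by
  let b := basisOfLinearIndependentOfCardEqFinrank hw (by simp)
  let B : (Fin 2 → ℂ) ≃L[ℂ] (Fin 2 → ℂ) := b.equivFun.symm.toContinuousLinearEquiv
  have hB : ∀ i, B (Pi.single i 1) = w i := by
    intro i
    change b.equivFun.symm (Pi.single i 1) = w i
    rw [LinearEquiv.symm_apply_eq]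
    have : b i = w i := by simp [b]
    ext j
    rw [← this, b.equivFun_self]
    simp [Pi.single_apply, eq_comm]
  have hBs : ∀ i, B.symm (w i) = Pi.single i 1 := fun i => by
    rw [← hB, B.symm_apply_apply]
  have hFB : AnalyticAt ℂ (fun z => F (B z)) 0 := by
    have h1 : AnalyticAt ℂ F (B 0) := by rwa [map_zero]
    exact h1.comp (B.toContinuousLinearMap.analyticAt 0)
  have hFB' : AnalyticAt ℂ (fun z => B.symm (F (B z))) 0 :=
    (B.symm.toContinuousLinearMap.analyticAt _).comp hFB
  have hd : ∀ v, fderiv ℂ (fun z => B.symm (F (B z))) 0 v = B.symm (fderiv ℂ F 0 (B v)) := by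
    intro v
    have h1 : HasFDerivAt F (fderiv ℂ F 0) (B 0) := by
      rw [map_zero]; exact hF.differentiableAt.hasFDerivAt
    have h2 := h1.comp (0 : Fin 2 → ℂ) B.hasFDerivAt
    have h3 := (B.symm.hasFDerivAt (x := F (B 0))).comp (0 : Fin 2 → ℂ) h2
    have h4 : fderiv ℂ (fun z => B.symm (F (B z))) 0 = _ := h3.fderiv
    rw [h4]; rfl
  obtain ⟨Φ, hΦ, hΦF⟩ := exists_linearization_of_diagonal hFB' (by simp [h0])
    (fun i => by rw [hd, hB, hlin, map_smul, hBs]) hΛ0 hΛ1 hres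
  have hΦB : HasFDerivAt (fun z => Φ (B.symm z))
      ((fderiv ℂ Φ 0).comp (B.symm : (Fin 2 → ℂ) →L[ℂ] (Fin 2 → ℂ))) 0 := by
    have h1 : HasFDerivAt Φ (fderiv ℂ Φ 0) (B.symm 0) := by
      rw [map_zero]; exact hΦ.1.differentiableAt.hasFDerivAt
    exact h1.comp (0 : Fin 2 → ℂ) B.symm.hasFDerivAt
  refine ⟨fun z => Φ (B.symm z), isGermDiffeo_of_injective_fderiv ?_ ?_ ?_, ?_⟩
  · have h1 : AnalyticAt ℂ Φ (B.symm 0) := by rw [map_zero]; exact hΦ.1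
    exact h1.comp (B.symm.toContinuousLinearMap.analyticAt 0)
  · simp [hΦ.2.1]
  · intro v hv
    rw [hΦB.fderiv] at hv
    simpa using hΦ.injective_fderiv hv
  · have h1 : Tendsto B.symm (𝓝 0) (𝓝 0) := by
      simpa using B.symm.continuous.tendsto 0
    filter_upwards [h1.eventually hΦF] with z hz i
    have := hz i
    rwa [B.apply_symm_apply] at this

/-- **Poincaré's linearization theorem** in dimension two, for a diagonalizable linear part with
nonresonant eigenvalues that are all inside or all outside the closed unit disc. -/
theorem exists_linearization {F : (Fin 2 → ℂ) → Fin 2 → ℂ} (hF : IsGermDiffeo F)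
    {Λ : Fin 2 → ℂ} {w : Fin 2 → Fin 2 → ℂ} (hw : LinearIndependent ℂ w)
    (hlin : ∀ i, fderiv ℂ F 0 (w i) = Λ i • w i)
    (hΛ : (∀ i, ‖Λ i‖ < 1) ∨ ∀ i, 1 < ‖Λ i‖) (hres : ∀ i, ∀ m : Fin 2 →₀ ℕ, 2 ≤ m.degree →
      (m.prod fun j e => Λ j ^ e) ≠ Λ i) :
    ∃ Φ : (Fin 2 → ℂ) → Fin 2 → ℂ, IsGermDiffeo Φ ∧
      ∀ᶠ z in 𝓝 0, ∀ i, Φ (F z) i = Λ i * Φ z i := by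
  have hΛ0 : ∀ i, Λ i ≠ 0 := by
    intro i hi
    have h1 := hlin i
    rw [hi, zero_smul] at h1
    exact hw.ne_zero i (hF.injective_fderiv h1)
  rcases hΛ with hΛ | hΛ
  · exact exists_linearization_of_norm_lt_one hF.1 hF.2.1 hw hlin hΛ0 hΛ hres
  -- In the expanding case the inverse germ is contracting, with the inverse eigenvalues; a chart
  -- linearizing it linearizes `F` too.
  · have hFt := hF.tendsto
    obtain ⟨hFa, hF0, G, hGa, hG0, hGF, hFG⟩ := hF
    have hd : (fderiv ℂ G 0).comp (fderiv ℂ F 0) = ContinuousLinearMap.id ℂ _ := by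
      have h3 : HasFDerivAt (fun z => G (F z)) ((fderiv ℂ G 0).comp (fderiv ℂ F 0)) 0 := by
        refine HasFDerivAt.comp (0 : Fin 2 → ℂ) ?_ hFa.differentiableAt.hasFDerivAt
        rw [hF0]; exact hGa.differentiableAt.hasFDerivAt
      exact h3.unique ((hasFDerivAt_id _).congr_of_eventuallyEq hGF)
    obtain ⟨Φ, hΦ, h⟩ := exists_linearization_of_norm_lt_one hGa hG0 (Λ := fun i => (Λ i)⁻¹) hw
      (fun i => by
        have h1 := congrArg (fun L => L (w i)) hd
        simp only [ContinuousLinearMap.comp_apply, hlin, map_smul, ContinuousLinearMap.id_apply]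
          at h1
        rw [← h1, smul_smul, inv_mul_cancel₀ (hΛ0 i), one_smul, h1])
      (fun i => inv_ne_zero (hΛ0 i))
      (fun i => by rw [norm_inv]; exact inv_lt_one_of_one_lt₀ (hΛ i))
      (fun i m hm he => hres i m hm (by
        simp only [inv_pow, Finsupp.prod, Finset.prod_inv_distrib] at he
        exact inv_injective he))
    refine ⟨Φ, hΦ, ?_⟩
    filter_upwards [hFt.eventually h, hGF] with z hz1 hz2 i
    have := hz1 i
    rw [hz2] at this
    rw [this, mul_inv_cancel_left₀ (hΛ0 i)]

end Linearization

/-! ### Linear and leading terms of formal substitutions. -/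

section FormalCurve

theorem constantCoeff_subst_eq {ι τ : Type*} [Finite ι] {G : ι → MvPowerSeries τ ℂ}
    (hG : ∀ i, constantCoeff (G i) = 0) (h : MvPowerSeries ι ℂ) :
    constantCoeff (subst G h) = constantCoeff h := by
  have hs := hasSubst_of_constantCoeff_zero hG
  have h1 := constantCoeff_subst_eq_zero hs hG (f := h - C (constantCoeff h)) (by simp)
  rw [subst_sub hs, map_sub, subst_C, sub_eq_zero] at h1
  simpa using h1

theorem coeff_single_mul {τ : Type*} (j : τ) (a b : MvPowerSeries τ ℂ) :
    coeff (Finsupp.single j 1) (a * b) = coeff (Finsupp.single j 1) a * constantCoeff b +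
      constantCoeff a * coeff (Finsupp.single j 1) b := by
  classical
  rw [coeff_mul, Finsupp.antidiagonal_single]
  simp [Finset.Nat.antidiagonal_succ, add_comm]

theorem powerSeries_eq_C_add_X_mul (α : PowerSeries ℂ) :
    ∃ β : PowerSeries ℂ, α = PowerSeries.C (PowerSeries.constantCoeff α) + PowerSeries.X * β ∧
      PowerSeries.constantCoeff β = PowerSeries.coeff 1 α := by
  obtain ⟨β, hβ⟩ := PowerSeries.X_dvd_iff.2
    (show PowerSeries.constantCoeff (α - PowerSeries.C (PowerSeries.constantCoeff α)) = 0 by simp)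
  refine ⟨β, by rw [← hβ]; ring, ?_⟩
  have := congrArg (PowerSeries.coeff 1) hβ
  rw [show (1 : ℕ) = 0 + 1 from rfl, PowerSeries.coeff_succ_X_mul] at this
  simpa [PowerSeries.coeff_C] using this.symm

theorem coeff_single_powerSeries_subst {τ : Type*} (j : τ) {b : MvPowerSeries τ ℂ}
    (hb : constantCoeff b = 0) (α : PowerSeries ℂ) :
    coeff (Finsupp.single j 1) (PowerSeries.subst b α) =
      PowerSeries.coeff 1 α * coeff (Finsupp.single j 1) b := by
  classical
  have hs := PowerSeries.HasSubst.of_constantCoeff_zero hb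
  obtain ⟨β, h1, h2⟩ := powerSeries_eq_C_add_X_mul α
  have h3 : constantCoeff (PowerSeries.subst b β) = PowerSeries.coeff 1 α := by
    rw [← h2]
    exact constantCoeff_subst_eq (fun _ : Unit => hb) β
  conv_lhs => rw [h1]
  rw [PowerSeries.subst_add hs, PowerSeries.subst_mul hs, PowerSeries.subst_X hs,
    PowerSeries.subst_C, map_add, coeff_single_mul, h3, hb, coeff_C]
  simp [mul_comm]

/-- Splitting off the part of a series in two variables that is divisible by the second one. -/
theorem exists_eq_subst_add_X_mul (h : Series2) :
    ∃ (α : PowerSeries ℂ) (β : Series2), h = PowerSeries.subst (X 0 : Series2) α + X 1 * β ∧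
      PowerSeries.coeff 1 α = coeff (Finsupp.single 0 1) h ∧
      constantCoeff β = coeff (Finsupp.single 1 1) h := by
  classical
  let α : PowerSeries ℂ := PowerSeries.mk fun n => coeff (Finsupp.single 0 n) h
  have hα : ∀ m : Fin 2 →₀ ℕ, m 1 = 0 → coeff m (PowerSeries.subst (X 0 : Series2) α) =
      coeff m h := by
    intro m hm
    have hm' : m = Finsupp.single 0 (m 0) := by
      ext i; fin_cases i <;> simp [hm]
    rw [PowerSeries.coeff_subst_single, if_pos hm', PowerSeries.coeff_mk, ← hm']
  obtain ⟨β, hβ⟩ := (X_dvd_iff (s := (1 : Fin 2)) (φ := h - PowerSeries.subst (X 0 : Series2) α)).2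
    fun m hm => by rw [map_sub, hα m hm, sub_self]
  have h1 : h = PowerSeries.subst (X 0 : Series2) α + X 1 * β := by rw [← hβ]; ring
  refine ⟨α, β, h1, PowerSeries.coeff_mk _ _, ?_⟩
  have h2 := congrArg (coeff (Finsupp.single (1 : Fin 2) 1)) h1
  rw [map_add, coeff_single_mul, coeff_single_powerSeries_subst _ (by simp)] at h2
  rw [h2]
  simp [coeff_X, Finsupp.single_left_inj]

theorem subst_eq_of_split {τ : Type*} {G : Fin 2 → MvPowerSeries τ ℂ} (hG : HasSubst G)
    {h : Series2} {α : PowerSeries ℂ} {β : Series2}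
    (hh : h = PowerSeries.subst (X 0 : Series2) α + X 1 * β) :
    subst G h = PowerSeries.subst (G 0) α + G 1 * subst G β := by
  have h1 : subst G (PowerSeries.subst (X 0 : Series2) α) = PowerSeries.subst (G 0) α := by
    have h2 := subst_comp_subst_apply (a := fun _ : Unit => (X 0 : Series2)) (b := G)
      (PowerSeries.HasSubst.X 0).const hG α
    rw [subst_X hG] at h2
    exact h2
  rw [hh, subst_add hG, subst_mul hG, subst_X hG, h1]

/-- The chain rule at the origin for formal series. Splitting `h` as `α(x) + y β` reduces it to one
variable and the product rule. -/
theorem coeff_single_subst {τ : Type*} (j : τ) {G : Fin 2 → MvPowerSeries τ ℂ}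
    (hG : ∀ i, constantCoeff (G i) = 0) (h : Series2) :
    coeff (Finsupp.single j 1) (subst G h) =
      ∑ i, coeff (Finsupp.single i 1) h * coeff (Finsupp.single j 1) (G i) := by
  obtain ⟨α, β, h1, h2, h3⟩ := exists_eq_subst_add_X_mul h
  rw [subst_eq_of_split (hasSubst_of_constantCoeff_zero hG) h1, map_add,
    coeff_single_powerSeries_subst _ (hG 0), coeff_single_mul, hG 1, constantCoeff_subst_eq hG,
    Fin.sum_univ_two, ← h2, ← h3]
  ring

theorem coeff_mul_of_forall_lt {n : ℕ} {a : PowerSeries ℂ}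
    (ha : ∀ k < n, PowerSeries.coeff k a = 0) (b : PowerSeries ℂ) :
    (∀ k < n, PowerSeries.coeff k (a * b) = 0) ∧
      PowerSeries.coeff n (a * b) = PowerSeries.coeff n a * PowerSeries.constantCoeff b := by
  obtain ⟨c, rfl⟩ := PowerSeries.X_pow_dvd_iff.2 ha
  refine ⟨fun k hk => ?_, ?_⟩
  · rw [mul_assoc, PowerSeries.coeff_X_pow_mul', if_neg (not_le.2 hk)]
  · rw [mul_assoc, PowerSeries.coeff_X_pow_mul', if_pos le_rfl, PowerSeries.coeff_X_pow_mul',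
      if_pos le_rfl]
    simp

theorem coeff_pow_of_forall_lt {n : ℕ} {a : PowerSeries ℂ}
    (ha : ∀ k < n, PowerSeries.coeff k a = 0) (j : ℕ) :
    (∀ k < n * j, PowerSeries.coeff k (a ^ j) = 0) ∧
      PowerSeries.coeff (n * j) (a ^ j) = PowerSeries.coeff n a ^ j := by
  obtain ⟨c, rfl⟩ := PowerSeries.X_pow_dvd_iff.2 ha
  refine ⟨fun k hk => ?_, ?_⟩
  · rw [mul_pow, ← pow_mul, PowerSeries.coeff_X_pow_mul', if_neg (not_le.2 hk)]
  · rw [mul_pow, ← pow_mul, PowerSeries.coeff_X_pow_mul', if_pos le_rfl,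
      PowerSeries.coeff_X_pow_mul', if_pos le_rfl]
    simp

/-- The leading term of `δ(b)` if `δ` vanishes to order `j` and `b` to order `n`. -/
theorem coeff_subst_of_forall_lt {n j : ℕ} (hn : 0 < n) {b δ : PowerSeries ℂ}
    (hb : ∀ k < n, PowerSeries.coeff k b = 0) (hδ : ∀ k < j, PowerSeries.coeff k δ = 0) :
    (∀ k < n * j, PowerSeries.coeff k (PowerSeries.subst b δ) = 0) ∧
      PowerSeries.coeff (n * j) (PowerSeries.subst b δ) =
        PowerSeries.coeff j δ * PowerSeries.coeff n b ^ j := by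
  have hb0 : PowerSeries.constantCoeff b = 0 := by
    rw [← PowerSeries.coeff_zero_eq_constantCoeff_apply]; exact hb 0 hn
  have hs : PowerSeries.HasSubst b := PowerSeries.HasSubst.of_constantCoeff_zero' hb0
  obtain ⟨c, rfl⟩ := PowerSeries.X_pow_dvd_iff.2 hδ
  have hc : PowerSeries.constantCoeff (PowerSeries.subst b c : PowerSeries ℂ) =
      PowerSeries.constantCoeff c := constantCoeff_subst_eq (fun _ : Unit => hb0) c
  obtain ⟨h1, h2⟩ := coeff_pow_of_forall_lt hb j
  obtain ⟨h3, h4⟩ := coeff_mul_of_forall_lt h1 (PowerSeries.subst b c : PowerSeries ℂ)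
  have h5 : (PowerSeries.subst b (PowerSeries.X ^ j * c) : PowerSeries ℂ) =
      b ^ j * PowerSeries.subst b c := by
    rw [PowerSeries.subst_mul hs, PowerSeries.subst_pow hs, PowerSeries.subst_X hs]
  rw [h5]
  refine ⟨h3, ?_⟩
  rw [h4, h2, hc, PowerSeries.coeff_X_pow_mul', if_pos le_rfl, mul_comm]
  simp

/-- The series `c - g(b)` can be made free of the monomials whose exponents are multiples of the
order of `b`. -/
theorem exists_series_coeff_sub_subst_eq_zero {n : ℕ} (hn : 0 < n) {b : PowerSeries ℂ}
    (hb : ∀ k < n, PowerSeries.coeff k b = 0) (hbn : PowerSeries.coeff n b ≠ 0)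
    (c : PowerSeries ℂ) : ∃ g : PowerSeries ℂ, ∀ k,
      PowerSeries.coeff (n * k) (c - PowerSeries.subst b g) = 0 := by
  have hb0 : PowerSeries.constantCoeff b = 0 := by
    rw [← PowerSeries.coeff_zero_eq_constantCoeff_apply]; exact hb 0 hn
  have hs : PowerSeries.HasSubst b := PowerSeries.HasSubst.of_constantCoeff_zero' hb0
  -- The coefficient of index `n * k` in `g(b)` is `g k` times the `k`-th power of the leading
  -- coefficient of `b`, plus a term in the earlier `g i`; the equations are thus solved one after
  -- another.
  obtain ⟨g, hg⟩ := exists_fixedPoint (R := ℂ) (fun k : ℕ => k)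
    (fun (g : ℕ → ℂ) k =>
      (PowerSeries.coeff (n * k) (c - PowerSeries.subst b (PowerSeries.mk g)) +
        g k * PowerSeries.coeff n b ^ k) / PowerSeries.coeff n b ^ k) (by
      intro k φ ψ h j hj
      congr 1
      have hδ : ∀ i < j, PowerSeries.coeff i (PowerSeries.mk φ - PowerSeries.mk ψ) = 0 := by
        intro i hi
        rw [map_sub, PowerSeries.coeff_mk, PowerSeries.coeff_mk, h i (by omega), sub_self]
      have h2 := (coeff_subst_of_forall_lt hn hb hδ).2
      rw [PowerSeries.subst_sub hs, map_sub, map_sub, PowerSeries.coeff_mk,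
        PowerSeries.coeff_mk] at h2
      rw [map_sub, map_sub]
      linear_combination -h2)
  refine ⟨PowerSeries.mk g, fun k => ?_⟩
  have := congrFun hg k
  rw [div_eq_iff (pow_ne_zero _ hbn)] at this
  linear_combination this

end FormalCurve

/-! ### Restriction to an invariant curve and the eigenvalues of the linear part. -/

section FormalEigenvalues

theorem isDiagonalToFirstOrder_powerSeries {θ : PowerSeries ℂ}
    (h0 : PowerSeries.constantCoeff θ = 0) :
    IsDiagonalToFirstOrder (fun _ : Unit => (θ : MvPowerSeries Unit ℂ))
      fun _ => PowerSeries.coeff 1 θ := by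
  refine ⟨fun i m hm => ?_⟩
  rcases eq_zero_or_single_of_degree_lt_two hm with rfl | ⟨j, rfl⟩
  · rw [coeff_zero_eq_constantCoeff_apply]
    refine Eq.trans h0 ?_
    simp
  · change PowerSeries.coeff 1 θ = _
    rw [coeff_smul, coeff_X, if_pos rfl, mul_one]

theorem coeff_powerSeries_subst_of_forall_lt {θ g : PowerSeries ℂ}
    (h0 : PowerSeries.constantCoeff θ = 0) {k : ℕ} (hg : ∀ j < k, PowerSeries.coeff j g = 0) :
    PowerSeries.coeff k (PowerSeries.subst θ g) =
      PowerSeries.coeff 1 θ ^ k * PowerSeries.coeff k g := by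
  have h := (coeff_subst_of_forall_lt one_pos (b := θ) (fun k hk => by
    rw [Nat.lt_one_iff.1 hk, PowerSeries.coeff_zero_eq_constantCoeff_apply, h0]) hg).2
  rw [one_mul] at h
  rw [h, mul_comm]

theorem exists_coeff_ne_zero_forall_lt {g : PowerSeries ℂ} (hg : g ≠ 0) :
    ∃ n, PowerSeries.coeff n g ≠ 0 ∧ ∀ j < n, PowerSeries.coeff j g = 0 :=
  ⟨g.order.toNat, PowerSeries.coeff_order hg, fun j hj => PowerSeries.coeff_of_lt_order_toNat j hj⟩

/-- Formal linearization of a series in one variable with a nonresonant multiplier. -/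
theorem exists_formal_linearization {θ : PowerSeries ℂ} (h0 : PowerSeries.constantCoeff θ = 0)
    (hθ : Function.Injective fun k : ℕ => PowerSeries.coeff 1 θ ^ k) :
    ∃ φ : PowerSeries ℂ, PowerSeries.constantCoeff φ = 0 ∧ PowerSeries.coeff 1 φ = 1 ∧
      PowerSeries.subst θ φ = PowerSeries.coeff 1 θ • φ := by
  obtain ⟨φ, h1, h2⟩ := exists_formal_eigenfunction (isDiagonalToFirstOrder_powerSeries h0) ()
    (fun m hm he => by
      have h3 : (m.prod fun _ e => PowerSeries.coeff 1 θ ^ e) =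
          PowerSeries.coeff 1 θ ^ m.degree := by
        rw [Finsupp.prod, Finset.prod_pow_eq_pow_sum]; rfl
      rw [h3] at he
      have := hθ (he.trans (pow_one _).symm)
      omega)
  refine ⟨φ, ?_, ?_, h2⟩
  · refine (h1 0 (by simp)).trans ?_
    simp
  · refine (h1 (Finsupp.single () 1) (by simp)).trans ?_
    rw [coeff_X, if_pos rfl]

/-- The difference of the two sides is again an eigenfunction for the `k`-th power of the
multiplier. Were it nonzero, its order would have to be `k` by injectivity of the powers, but its
coefficient of index `k` is zero. -/
theorem eq_smul_pow_of_subst_eq_smul {θ φ g : PowerSeries ℂ}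
    (h0 : PowerSeries.constantCoeff θ = 0)
    (hθ : Function.Injective fun k : ℕ => PowerSeries.coeff 1 θ ^ k)
    (hφ0 : PowerSeries.constantCoeff φ = 0) (hφ1 : PowerSeries.coeff 1 φ = 1)
    (hφ : PowerSeries.subst θ φ = PowerSeries.coeff 1 θ • φ) {k : ℕ}
    (hg : PowerSeries.subst θ g = PowerSeries.coeff 1 θ ^ k • g) :
    g = PowerSeries.coeff k g • φ ^ k := by
  have hs : PowerSeries.HasSubst θ := PowerSeries.HasSubst.of_constantCoeff_zero' h0
  by_contra hne
  obtain ⟨n, hn, hlt⟩ := exists_coeff_ne_zero_forall_lt (sub_ne_zero.2 hne)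
  have h1 : PowerSeries.subst θ (g - PowerSeries.coeff k g • φ ^ k) =
      PowerSeries.coeff 1 θ ^ k • (g - PowerSeries.coeff k g • φ ^ k) := by
    rw [PowerSeries.subst_sub hs, PowerSeries.subst_smul hs, PowerSeries.subst_pow hs, hφ, hg,
      smul_pow, smul_sub, smul_comm]
  have h2 := coeff_powerSeries_subst_of_forall_lt h0 hlt
  rw [h1, PowerSeries.coeff_smul] at h2
  have h3 : k = n := hθ (mul_right_cancel₀ hn h2)
  subst h3
  have h4 := (coeff_pow_of_forall_lt (n := 1) (a := φ) (fun k hk => by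
    rw [Nat.lt_one_iff.1 hk, PowerSeries.coeff_zero_eq_constantCoeff_apply, hφ0]) k).2
  rw [one_mul, hφ1, one_pow] at h4
  rw [map_sub, PowerSeries.coeff_smul, h4, smul_eq_mul, mul_one, sub_self] at hn
  exact hn rfl

theorem powerSeries_subst_subst {ι τ : Type*} [Finite ι] {G : ι → MvPowerSeries τ ℂ}
    (hG : ∀ i, constantCoeff (G i) = 0) {b : MvPowerSeries ι ℂ} (hb : constantCoeff b = 0)
    (g : PowerSeries ℂ) :
    subst G (PowerSeries.subst b g) = PowerSeries.subst (subst G b) g :=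
  subst_comp_subst_apply (a := fun _ : Unit => b)
    (PowerSeries.HasSubst.of_constantCoeff_zero hb).const (hasSubst_of_constantCoeff_zero hG) g

theorem powerSeries_subst_comp {θ : PowerSeries ℂ} (hθ : PowerSeries.constantCoeff θ = 0)
    {b : PowerSeries ℂ} (hb : PowerSeries.constantCoeff b = 0) (g : PowerSeries ℂ) :
    PowerSeries.subst θ (PowerSeries.subst b g : PowerSeries ℂ) =
      (PowerSeries.subst (PowerSeries.subst θ b : PowerSeries ℂ) g : PowerSeries ℂ) :=
  powerSeries_subst_subst (G := fun _ : Unit => θ) (fun _ => hθ) hb g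

theorem powerSeries_subst_subst_left {ι : Type*} [Finite ι] {γ : ι → PowerSeries ℂ}
    (hγ : ∀ i, PowerSeries.constantCoeff (γ i) = 0) {θ : PowerSeries ℂ}
    (hθ : PowerSeries.constantCoeff θ = 0) (h : MvPowerSeries ι ℂ) :
    PowerSeries.subst θ (subst γ h : PowerSeries ℂ) =
      subst (fun i => (PowerSeries.subst θ (γ i) : PowerSeries ℂ)) h :=
  subst_comp_subst_apply (b := fun _ : Unit => θ) (hasSubst_of_constantCoeff_zero hγ)
    (PowerSeries.HasSubst.of_constantCoeff_zero hθ).const h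

variable {f : Fin 2 → Series2} {γ : Fin 2 → PowerSeries ℂ} {θ : PowerSeries ℂ}

/-- The eigenvalues of the linear part of a formal map `f` that leaves a singular parametrized
curve `γ` invariant, where the first component of `γ` has the smallest order. -/
theorem exists_eigenvectors_of_order_le (hf0 : ∀ i, constantCoeff (f i) = 0)
    (hγ0 : ∀ i, PowerSeries.constantCoeff (γ i) = 0) (hθ0 : PowerSeries.constantCoeff θ = 0)
    (hfγ : ∀ i, subst γ (f i) = PowerSeries.subst θ (γ i))
    (hsing : ∀ h : Series2, subst γ h = 0 → ∀ j, coeff (Finsupp.single j 1) h = 0)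
    {n : ℕ} (hn : PowerSeries.coeff n (γ 0) ≠ 0)
    (hlt : ∀ i, ∀ k < n, PowerSeries.coeff k (γ i) = 0) :
    ∃ m, n < m ∧ ¬ n ∣ m ∧ ∃ w u : Fin 2 → ℂ, w ≠ 0 ∧ u ≠ 0 ∧
      (∀ i, ∑ j, coeff (Finsupp.single j 1) (f i) * w j = PowerSeries.coeff 1 θ ^ n * w i) ∧
      ∀ j, ∑ i, u i * coeff (Finsupp.single j 1) (f i) = PowerSeries.coeff 1 θ ^ m * u j := by
  have hsγ : HasSubst γ := hasSubst_of_constantCoeff_zero hγ0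
  have hsθ : PowerSeries.HasSubst θ := PowerSeries.HasSubst.of_constantCoeff_zero' hθ0
  have hn0 : 0 < n := by
    rcases Nat.eq_zero_or_pos n with rfl | h
    · exact absurd (by rw [PowerSeries.coeff_zero_eq_constantCoeff_apply, hγ0]) hn
    · exact h
  obtain ⟨g, hg⟩ := exists_series_coeff_sub_subst_eq_zero hn0 (hlt 0) hn (γ 1)
  set D : PowerSeries ℂ := γ 1 - PowerSeries.subst (γ 0) g with hD
  have hX0 : constantCoeff (X 0 : Series2) = 0 := constantCoeff_X 0
  have hsγ0 : PowerSeries.HasSubst (γ 0) := PowerSeries.HasSubst.of_constantCoeff_zero' (hγ0 0)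
  have hg0 : PowerSeries.constantCoeff g = 0 := by
    have h1 := hg 0
    have h2 : PowerSeries.constantCoeff (PowerSeries.subst (γ 0) g : PowerSeries ℂ) =
        PowerSeries.constantCoeff g := constantCoeff_subst_eq (fun _ : Unit => hγ0 0) g
    rw [mul_zero, PowerSeries.coeff_zero_eq_constantCoeff_apply, map_sub, hγ0, h2, zero_sub,
      neg_eq_zero] at h1
    exact h1
  have hgX : subst γ (PowerSeries.subst (X 0 : Series2) g) = PowerSeries.subst (γ 0) g := by
    rw [powerSeries_subst_subst hγ0 hX0, subst_X hsγ]
  -- Otherwise `y - g(x)` would vanish on the curve, although its linear part is nonzero.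
  have hDne : D ≠ 0 := by
    intro h0
    have h1 := hsing (X 1 - PowerSeries.subst (X 0 : Series2) g)
      (by rw [subst_sub hsγ, subst_X hsγ, hgX]; exact h0) 1
    rw [map_sub, coeff_single_powerSeries_subst _ hX0] at h1
    simp [coeff_X, Finsupp.single_left_inj] at h1
  obtain ⟨m, hm, hmlt⟩ := exists_coeff_ne_zero_forall_lt hDne
  have hnm : ¬ n ∣ m := by
    rintro ⟨k, rfl⟩
    exact hm (hg k)
  have hDn : ∀ k < n, PowerSeries.coeff k D = 0 := by
    intro k hk
    have h1 := (coeff_subst_of_forall_lt hn0 (hlt 0) (δ := g) (j := 1) (fun i hi => by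
      rw [Nat.lt_one_iff.1 hi, PowerSeries.coeff_zero_eq_constantCoeff_apply, hg0])).1 k
        (by omega)
    rw [hD, map_sub, hlt 1 k hk, h1, sub_zero]
  have hnltm : n < m := by
    rcases lt_trichotomy n m with h | h | h
    · exact h
    · exact absurd (h ▸ dvd_rfl) hnm
    · exact absurd (hDn m h) hm
  set g₁ := PowerSeries.coeff 1 g with hg₁
  set h : Series2 := f 1 - PowerSeries.subst (f 0) g with hh
  -- In the coordinates `(x, y - g(x))` the curve becomes `γ' = (γ 0, D)`, and `subst σ h` is the
  -- second component of the map `f` as a function of the new coordinates, so its value along `γ'`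
  -- is `D ∘ θ`.
  let σ : Fin 2 → Series2 := ![X 0, X 1 + PowerSeries.subst (X 0 : Series2) g]
  have hσ0 : ∀ i, constantCoeff (σ i) = 0 := by
    intro i
    fin_cases i
    · exact hX0
    · have : constantCoeff (PowerSeries.subst (X 0 : Series2) g) = PowerSeries.constantCoeff g :=
        constantCoeff_subst_eq (fun _ : Unit => hX0) g
      change constantCoeff (X 1 + PowerSeries.subst (X 0 : Series2) g) = 0
      rw [map_add, this, hg0]
      simp
  let γ' : Fin 2 → PowerSeries ℂ := ![γ 0, D]
  have hγ'0 : ∀ i, PowerSeries.constantCoeff (γ' i) = 0 := by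
    intro i
    fin_cases i
    · exact hγ0 0
    · change PowerSeries.constantCoeff D = 0
      rw [← PowerSeries.coeff_zero_eq_constantCoeff_apply]
      exact hDn 0 hn0
  have hsγ' : HasSubst γ' := hasSubst_of_constantCoeff_zero hγ'0
  have hcomp : subst γ' (subst σ h) = PowerSeries.subst θ D := by
    rw [subst_comp_subst_apply (hasSubst_of_constantCoeff_zero hσ0) hsγ']
    have h1 : (fun s => subst γ' (σ s)) = γ := by
      ext1 i
      fin_cases i
      · exact subst_X hsγ' 0
      · change subst γ' (X 1 + PowerSeries.subst (X 0 : Series2) g) = γ 1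
        rw [subst_add hsγ', subst_X hsγ', powerSeries_subst_subst hγ'0 hX0, subst_X hsγ']
        change γ 1 - PowerSeries.subst (γ 0) g + PowerSeries.subst (γ 0) g = γ 1
        ring
    rw [h1, hh, subst_sub hsγ, powerSeries_subst_subst hγ0 (hf0 0), hfγ, hfγ, hD,
      PowerSeries.subst_sub hsθ, powerSeries_subst_comp hθ0 (hγ0 0)]
  obtain ⟨α, β, hαβ, hα1, hβ0⟩ := exists_eq_subst_add_X_mul (subst σ h)
  rw [subst_eq_of_split hsγ' hαβ] at hcomp
  change (PowerSeries.subst (γ 0) α : PowerSeries ℂ) + D * subst γ' β = _ at hcomp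
  have hβ : PowerSeries.constantCoeff (subst γ' β : PowerSeries ℂ) = constantCoeff β :=
    constantCoeff_subst_eq hγ'0 β
  obtain ⟨hDβ1, hDβ2⟩ := coeff_mul_of_forall_lt hmlt (subst γ' β : PowerSeries ℂ)
  have hθD : ∀ k < m, PowerSeries.coeff k (PowerSeries.subst θ D) = 0 := by
    intro k hk
    rw [coeff_powerSeries_subst_of_forall_lt hθ0 fun j hj => hmlt j (hj.trans hk), hmlt k hk,
      mul_zero]
  have hαlt : ∀ k < m, PowerSeries.coeff k (PowerSeries.subst (γ 0) α : PowerSeries ℂ) = 0 := by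
    intro k hk
    have h1 := congrArg (PowerSeries.coeff k) hcomp
    rwa [map_add, hDβ1 k hk, add_zero, hθD k hk] at h1
  -- The order of `α(γ 0)` is a multiple `n * k` of `n`. It is at least `m` and cannot equal `m`, so
  -- it exceeds `m`; with `n < m` this forces `k > 1`.
  have hα : PowerSeries.coeff m (PowerSeries.subst (γ 0) α : PowerSeries ℂ) = 0 ∧
      PowerSeries.coeff 1 α = 0 := by
    by_cases hα0 : α = 0
    · rw [hα0, ← PowerSeries.coe_substAlgHom hsγ0, map_zero]
      simp
    obtain ⟨k, hk, hklt⟩ := exists_coeff_ne_zero_forall_lt hα0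
    obtain ⟨h1, h2⟩ := coeff_subst_of_forall_lt hn0 (hlt 0) hklt
    have h3 : m < n * k := by
      rcases lt_trichotomy m (n * k) with h | h | h
      · exact h
      · exact absurd ⟨k, h⟩ hnm
      · have := hαlt _ h
        rw [h2] at this
        exact absurd this (mul_ne_zero hk (pow_ne_zero _ hn))
    refine ⟨h1 m h3, hklt 1 ?_⟩
    by_contra hk1
    have : n * k ≤ n * 1 := Nat.mul_le_mul_left n (not_lt.1 hk1)
    omega
  -- Only `D * β` contributes in degree `m`, to be compared with the leading term of `D ∘ θ`.
  have hβm : constantCoeff β = PowerSeries.coeff 1 θ ^ m := by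
    have h1 := congrArg (PowerSeries.coeff m) hcomp
    rw [map_add, hα.1, zero_add, hDβ2, hβ, coeff_powerSeries_subst_of_forall_lt hθ0 hmlt,
      mul_comm] at h1
    exact mul_right_cancel₀ hm h1
  have hlin : ∀ j, coeff (Finsupp.single j 1) h = coeff (Finsupp.single j 1) (f 1) -
      g₁ * coeff (Finsupp.single j 1) (f 0) := fun j => by
    rw [hh, map_sub, coeff_single_powerSeries_subst _ (hf0 0)]
  have hl : ∀ j, coeff (Finsupp.single j 1) (subst σ h) = coeff (Finsupp.single 0 1) h *
      coeff (Finsupp.single j 1) (X 0 : Series2) + coeff (Finsupp.single 1 1) h *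
      (coeff (Finsupp.single j 1) (X 1 : Series2) +
        g₁ * coeff (Finsupp.single j 1) (X 0 : Series2)) := fun j => by
    rw [coeff_single_subst j hσ0, Fin.sum_univ_two]
    change _ * coeff _ (X 0 : Series2) + _ * coeff _ (X 1 + PowerSeries.subst (X 0 : Series2) g) = _
    rw [map_add, coeff_single_powerSeries_subst _ hX0]
  have hl0 := hl 0
  have hl1 := hl 1
  rw [← hα1, hα.2] at hl0
  rw [← hβ0, hβm] at hl1
  simp only [coeff_X, Finsupp.single_left_inj one_ne_zero, hlin] at hl0 hl1
  norm_num at hl0 hl1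
  -- The right eigenvector is the leading vector of `γ`, tangent to the curve. The left eigenvector
  -- is the differential of `y - g(x)`, because `α` has no linear term.
  refine ⟨m, hnltm, hnm, fun i => PowerSeries.coeff n (γ i), ![-g₁, 1], fun hw => hn (congrFun hw 0),
    fun hu => one_ne_zero (congrFun hu 1), fun i => ?_, fun j => ?_⟩
  · obtain ⟨α, β, h1, h2, h3⟩ := exists_eq_subst_add_X_mul (f i)
    have h4 := congrArg (PowerSeries.coeff n) (hfγ i)
    rw [subst_eq_of_split hsγ h1, map_add, (coeff_mul_of_forall_lt (hlt 1) _).2,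
      coeff_powerSeries_subst_of_forall_lt hθ0 (hlt i)] at h4
    have h5 : PowerSeries.constantCoeff (subst γ β : PowerSeries ℂ) = constantCoeff β :=
      constantCoeff_subst_eq hγ0 β
    have h6 : PowerSeries.constantCoeff α = 0 := by
      have h7 := congrArg (constantCoeff (σ := Fin 2) (R := ℂ)) h1
      have h8 : constantCoeff (PowerSeries.subst (X 0 : Series2) α) =
        PowerSeries.constantCoeff α := constantCoeff_subst_eq (fun _ : Unit => hX0) α
      rw [hf0, map_add, h8, map_mul] at h7
      simpa using h7.symm
    have h7 := (coeff_subst_of_forall_lt hn0 (hlt 0) (δ := α) (j := 1) (fun i hi => by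
      rw [Nat.lt_one_iff.1 hi, PowerSeries.coeff_zero_eq_constantCoeff_apply, h6])).2
    rw [mul_one, pow_one] at h7
    rw [h7, h5, h2, h3] at h4
    rw [Fin.sum_univ_two, ← h4]
    ring
  · rw [Fin.sum_univ_two]
    fin_cases j
    · change -g₁ * _ + 1 * _ = _ * -g₁
      simp only [Fin.zero_eta]
      linear_combination hl1 * g₁ - hl0
    · change -g₁ * _ + 1 * _ = _ * 1
      simp only [Fin.mk_one]
      linear_combination -hl1

/-- The eigenvalues of the linear part of a formal map `f` that leaves a singular parametrized
curve `γ` invariant are powers of the multiplier of the restriction of `f` to the curve. -/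
theorem exists_eigenvectors (hf0 : ∀ i, constantCoeff (f i) = 0)
    (hγ0 : ∀ i, PowerSeries.constantCoeff (γ i) = 0) (hθ0 : PowerSeries.constantCoeff θ = 0)
    (hfγ : ∀ i, subst γ (f i) = PowerSeries.subst θ (γ i))
    (hsing : ∀ h : Series2, subst γ h = 0 → ∀ j, coeff (Finsupp.single j 1) h = 0) :
    ∃ n m, 0 < n ∧ n < m ∧ ¬ n ∣ m ∧ ∃ w u : Fin 2 → ℂ, w ≠ 0 ∧ u ≠ 0 ∧
      (∀ i, ∑ j, coeff (Finsupp.single j 1) (f i) * w j = PowerSeries.coeff 1 θ ^ n * w i) ∧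
      ∀ j, ∑ i, u i * coeff (Finsupp.single j 1) (f i) = PowerSeries.coeff 1 θ ^ m * u j := by
  have hsγ : HasSubst γ := hasSubst_of_constantCoeff_zero hγ0
  have hne : ∀ i, γ i ≠ 0 := by
    intro i hi
    have := hsing (X i) (by rw [subst_X hsγ, hi]) i
    rw [coeff_X, if_pos rfl] at this
    exact one_ne_zero this
  have hpos : ∀ n i, PowerSeries.coeff n (γ i) ≠ 0 → 0 < n := by
    intro n i hn
    rcases Nat.eq_zero_or_pos n with rfl | h
    · exact absurd (by rw [PowerSeries.coeff_zero_eq_constantCoeff_apply, hγ0]) hn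
    · exact h
  obtain ⟨n₀, h0, h0'⟩ := exists_coeff_ne_zero_forall_lt (hne 0)
  obtain ⟨n₁, h1, h1'⟩ := exists_coeff_ne_zero_forall_lt (hne 1)
  rcases le_total n₀ n₁ with hle | hle
  · obtain ⟨m, hm⟩ := exists_eigenvectors_of_order_le hf0 hγ0 hθ0 hfγ hsing h0 (fun i k hk => by
      fin_cases i
      · exact h0' k hk
      · exact h1' k (hk.trans_le hle))
    exact ⟨n₀, m, hpos _ _ h0, hm⟩
  -- When `γ 1` has the smaller order, both the map and the curve are conjugated by the exchange of
  -- the coordinates.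
  · let e : Fin 2 → Fin 2 := ![1, 0]
    have he : ∀ i, e (e i) = i := by decide
    have hX : ∀ i, constantCoeff (X (e i) : Series2) = 0 := fun i => constantCoeff_X _
    have hsX : HasSubst fun i => (X (e i) : Series2) := hasSubst_of_constantCoeff_zero hX
    have hcomp : ∀ h : Series2, subst (fun i => γ (e i)) (subst (fun i => (X (e i) : Series2)) h) =
        subst γ h := by
      intro h
      have hs : HasSubst fun i => γ (e i) := hasSubst_of_constantCoeff_zero fun i => hγ0 (e i)
      rw [subst_comp_subst_apply hsX hs]
      congr 1
      ext1 i
      rw [subst_X hs, he]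
    have hcomp' : ∀ h : Series2, subst γ (subst (fun i => (X (e i) : Series2)) h) =
        subst (fun i => γ (e i)) h := by
      intro h
      rw [subst_comp_subst_apply hsX hsγ]
      congr 1
      ext1 i
      rw [subst_X hsγ]
    have hlin : ∀ (h : Series2) j, coeff (Finsupp.single j 1)
        (subst (fun i => (X (e i) : Series2)) h) = coeff (Finsupp.single (e j) 1) h := by
      intro h j
      rw [coeff_single_subst j hX, Fin.sum_univ_two]
      fin_cases j <;> simp [e, coeff_X, Finsupp.single_left_inj]
    have hsum : ∀ g : Fin 2 → ℂ, ∑ i, g (e i) = ∑ i, g i := fun g => by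
      simp [e, Fin.sum_univ_two, add_comm]
    obtain ⟨m, hm, hd, w, u, hw, hu, hA, hB⟩ := exists_eigenvectors_of_order_le
      (f := fun i => subst (fun i => (X (e i) : Series2)) (f (e i))) (γ := fun i => γ (e i))
      (fun i => by rw [constantCoeff_subst_eq hX, hf0]) (fun i => hγ0 (e i)) hθ0
      (fun i => by rw [hcomp, hfγ])
      (fun h hh j => by
        rw [← hcomp'] at hh
        have := hsing _ hh (e j)
        rwa [hlin, he] at this) h1 (fun i k hk => by
        fin_cases i
        · exact h1' k hk
        · exact h0' k (hk.trans_le hle))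
    refine ⟨n₁, m, hpos _ _ h1, hm, hd, fun i => w (e i), fun i => u (e i), ?_, ?_, ?_, ?_⟩
    · intro h
      refine hw (funext fun i => ?_)
      have := congrFun h (e i)
      rwa [he] at this
    · intro h
      refine hu (funext fun i => ?_)
      have := congrFun h (e i)
      rwa [he] at this
    · intro i
      have := hA (e i)
      simp only [hlin, he] at this
      rw [← this, ← hsum]
      simp only [he]
    · intro j
      have := hB (e j)
      simp only [hlin, he] at this
      rw [← this, ← hsum]
      simp only [he]

end FormalEigenvalues

/-! ### The ideal of the curve `y ^ p = x ^ q`. -/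

section Cusp

theorem exists_shift_of_mul_add_mul_eq {p q i j i' j' : ℕ} (hp : 0 < p) (hpq : p.Coprime q)
    (hj : j < p) (h : p * i' + q * j' = p * i + q * j) :
    ∃ k, i = i' + k * q ∧ j' = j + k * p := by
  have h1 : q * j' ≡ q * j [MOD p] := by
    have h2 := congrArg (· % p) h
    simpa [Nat.ModEq, Nat.mul_add_mod] using h2
  have h2 : j' ≡ j [MOD p] := Nat.ModEq.cancel_left_of_coprime hpq h1
  have h3 : j' % p = j := (show j' % p = j % p from h2).trans (Nat.mod_eq_of_lt hj)
  have h4 := Nat.mod_add_div j' p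
  rw [h3] at h4
  refine ⟨j' / p, ?_, by rw [mul_comm, h4]⟩
  refine Nat.eq_of_mul_eq_mul_left hp ?_
  rw [← h4] at h
  nlinarith

theorem coeff_subst_X_pow {p q : ℕ} (hp : 0 < p) (hq : 0 < q) (h : Series2) (N : ℕ) :
    PowerSeries.coeff N
      (subst ![(PowerSeries.X ^ p : PowerSeries ℂ), PowerSeries.X ^ q] h : PowerSeries ℂ) =
      finsum fun d : Fin 2 →₀ ℕ => if N = p * d 0 + q * d 1 then coeff d h else 0 := by
  have hs : HasSubst ![(PowerSeries.X ^ p : PowerSeries ℂ), PowerSeries.X ^ q] :=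
    hasSubst_of_constantCoeff_zero fun i => by
      fin_cases i
      · change PowerSeries.constantCoeff (PowerSeries.X ^ p : PowerSeries ℂ) = 0
        simp [hp.ne']
      · change PowerSeries.constantCoeff (PowerSeries.X ^ q : PowerSeries ℂ) = 0
        simp [hq.ne']
  refine (coeff_subst hs h (Finsupp.single () N)).trans (finsum_congr fun d => ?_)
  have h1 : (d.prod fun s e => ![(PowerSeries.X ^ p : PowerSeries ℂ), PowerSeries.X ^ q] s ^ e) =
      PowerSeries.X ^ (p * d 0 + q * d 1) := by
    rw [prod_pow_fin_two, pow_add, pow_mul, pow_mul]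
    rfl
  rw [h1]
  change coeff d h • PowerSeries.coeff N (PowerSeries.X ^ (p * d 0 + q * d 1) : PowerSeries ℂ) = _
  rw [PowerSeries.coeff_X_pow]
  split_ifs <;> simp

theorem coeff_X_pow_mul_pairEquiv_zero (n i j : ℕ) (w : Series2) :
    coeff (pairEquiv (i, j)) (X 0 ^ n * w) =
      if n ≤ i then coeff (pairEquiv (i - n, j)) w else 0 := by
  classical
  have h : pairEquiv (i, j) - Finsupp.single 0 n = pairEquiv (i - n, j) := by
    ext s; fin_cases s <;> simp
  rw [X_pow_eq, coeff_monomial_mul, one_mul, h]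
  simp only [Finsupp.single_le_iff, pairEquiv_apply_zero]

theorem coeff_X_pow_mul_pairEquiv_one (n i j : ℕ) (w : Series2) :
    coeff (pairEquiv (i, j)) (X 1 ^ n * w) =
      if n ≤ j then coeff (pairEquiv (i, j - n)) w else 0 := by
  classical
  have h : pairEquiv (i, j) - Finsupp.single 1 n = pairEquiv (i, j - n) := by
    ext s; fin_cases s <;> simp
  rw [X_pow_eq, coeff_monomial_mul, one_mul, h]
  simp only [Finsupp.single_le_iff, pairEquiv_apply_one]

/-- The ideal of the curve `y ^ p = x ^ q` consists of the series that vanish along its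
parametrization `(s ^ p, s ^ q)`. -/
theorem mem_cusp_iff {p q : ℕ} (hp : 0 < p) (hq : 0 < q) (hpq : p.Coprime q) (h : Series2) :
    h ∈ cusp p q ↔
      (subst ![(PowerSeries.X ^ p : PowerSeries ℂ), PowerSeries.X ^ q] h : PowerSeries ℂ) = 0 := by
  classical
  have hs : HasSubst ![(PowerSeries.X ^ p : PowerSeries ℂ), PowerSeries.X ^ q] :=
    hasSubst_of_constantCoeff_zero fun i => by
      fin_cases i
      · change PowerSeries.constantCoeff (PowerSeries.X ^ p : PowerSeries ℂ) = 0
        simp [hp.ne']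
      · change PowerSeries.constantCoeff (PowerSeries.X ^ q : PowerSeries ℂ) = 0
        simp [hq.ne']
  rw [cusp, Ideal.mem_span_singleton]
  constructor
  · rintro ⟨k, rfl⟩
    rw [subst_mul hs, subst_sub hs, subst_pow hs, subst_pow hs, subst_X hs, subst_X hs]
    change ((PowerSeries.X ^ q : PowerSeries ℂ) ^ p - (PowerSeries.X ^ p : PowerSeries ℂ) ^ q) * _
      = _
    rw [← pow_mul, ← pow_mul, mul_comm q p, sub_self, zero_mul]
  · intro h0
    let H : ℕ → ℕ → ℂ := fun i j => coeff (pairEquiv (i, j)) h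
    -- If `h = (y ^ p - x ^ q) w`, then `H i j = w (i, j - p) - w (i - q, j)`. Solving this by
    -- telescoping along the exponents of equal weight `p i + q j` gives `w (i, j) = T i (j + p)`.
    let T : ℕ → ℕ → ℂ := fun i j => ∑ k ∈ Finset.range (i / q + 1), H (i - k * q) (j + k * p)
    have hT : ∀ i j, T i j = H i j + if q ≤ i then T (i - q) (j + p) else 0 := by
      intro i j
      simp only [T]
      rw [Finset.sum_range_succ', zero_mul, zero_mul, Nat.sub_zero, add_zero, add_comm]
      congr 1
      split_ifs with hqi
      · rw [Nat.div_eq_sub_div hq hqi]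
        refine Finset.sum_congr rfl fun k _ => ?_
        rw [Nat.sub_sub, add_assoc]
        congr 2 <;> ring
      · rw [Nat.div_eq_of_lt (not_le.1 hqi)]
        rfl
    -- For `j < p` the sum runs over all exponents of weight `p i + q j`, by coprimality, and hence
    -- is a coefficient of `h(s ^ p, s ^ q)`. These are the conditions for the division to leave no
    -- remainder.
    have hT0 : ∀ i j, j < p → T i j = 0 := by
      intro i j hj
      have h1 := coeff_subst_X_pow hp hq h (p * i + q * j)
      rw [h0, map_zero] at h1
      have hinj : Function.Injective fun k => pairEquiv (i - k * q, j + k * p) := by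
        intro k k' hk
        have := (Prod.mk.inj (pairEquiv.injective hk)).2
        exact Nat.eq_of_mul_eq_mul_right hp (by omega)
      rw [finsum_eq_sum_of_support_subset (s := (Finset.range (i / q + 1)).image
        fun k => pairEquiv (i - k * q, j + k * p)), Finset.sum_image hinj.injOn] at h1
      · rw [h1]
        refine Finset.sum_congr rfl fun k hk => ?_
        rw [if_pos]
        have hk' : k * q ≤ i := (Nat.le_div_iff_mul_le hq).1 (by
          have := Finset.mem_range.1 hk; omega)
        obtain ⟨t, rfl⟩ := Nat.exists_eq_add_of_le hk'
        rw [pairEquiv_apply_zero, pairEquiv_apply_one, Nat.add_sub_cancel_left]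
        ring
      · intro d hd
        have hd' : p * i + q * j = p * d 0 + q * d 1 := by
          by_contra hne
          exact hd (if_neg hne)
        obtain ⟨k, hk1, hk2⟩ := exists_shift_of_mul_add_mul_eq hp hpq hj hd'.symm
        simp only [Finset.coe_image, Set.mem_image, Finset.coe_range, Set.mem_Iio]
        refine ⟨k, Nat.lt_succ_iff.2 ((Nat.le_div_iff_mul_le hq).2 (by omega)), ?_⟩
        rw [eq_pairEquiv d, hk2, hk1, Nat.add_sub_cancel]
    let w : Series2 := fun m => T (m 0) (m 1 + p)
    have hw : ∀ i j, coeff (pairEquiv (i, j)) w = T i (j + p) := fun _ _ => rfl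
    refine ⟨w, ?_⟩
    ext m
    rw [eq_pairEquiv m, sub_mul, map_sub, coeff_X_pow_mul_pairEquiv_one,
      coeff_X_pow_mul_pairEquiv_zero]
    generalize m 0 = i, m 1 = j
    change H i j = _
    have h1 := hT i j
    simp only [hw]
    by_cases hj : p ≤ j
    · rw [if_pos hj, Nat.sub_add_cancel hj, h1]
      ring
    · rw [if_neg hj]
      rw [hT0 i j (not_le.1 hj)] at h1
      linear_combination -h1

end Cusp

/-! ### Multiplicity, tangent line and tangent eigenvalue of a cusp in a chart. -/

section TangentLine

/-- Restriction to the line `t ↦ t v` turns homogeneous components into coefficients, so the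
one-variable lemmas on leading terms apply. -/
theorem homogeneousPartAt_eq_coeff (n : ℕ) (h : Series2) (v : Fin 2 → ℂ) :
    homogeneousPartAt n h v =
      PowerSeries.coeff n (subst (fun i => (v i • PowerSeries.X : PowerSeries ℂ)) h) := by
  have hs : HasSubst fun i => (v i • PowerSeries.X : PowerSeries ℂ) :=
    hasSubst_of_constantCoeff_zero fun i => by
      change PowerSeries.constantCoeff (v i • PowerSeries.X : PowerSeries ℂ) = 0
      simp [PowerSeries.smul_eq_C_mul]
  have h1 : ∀ d : Fin 2 →₀ ℕ, PowerSeries.coeff n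
      (d.prod fun i e => (v i • PowerSeries.X : PowerSeries ℂ) ^ e) =
        if n = d.degree then ∏ i, v i ^ d i else 0 := by
    intro d
    rw [prod_pow_fin_two, smul_pow, smul_pow, smul_mul_smul_comm, ← pow_add, ← degree_fin_two,
      PowerSeries.coeff_smul, PowerSeries.coeff_X_pow, Fin.prod_univ_two]
    simp
  refine Eq.symm ((coeff_subst hs h (Finsupp.single () n)).trans ?_)
  rw [finsum_eq_sum_of_support_subset
    (s := (Finset.univ : Finset (Fin 2)).finsuppAntidiag n)]
  · refine Finset.sum_congr rfl fun d hd => ?_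
    have hd' : n = d.degree := by
      rw [degree_fin_two, ← (Finset.mem_finsuppAntidiag.1 hd).1, Fin.sum_univ_two]
    have h2 := h1 d
    rw [if_pos hd'] at h2
    rw [← h2]
    rfl
  · intro d hd
    refine Finset.mem_coe.2 (Finset.mem_finsuppAntidiag.2 ⟨?_, Finset.subset_univ _⟩)
    by_contra hne
    refine hd ?_
    have h2 := h1 d
    rw [if_neg (fun h => hne (by rw [h, degree_fin_two, Fin.sum_univ_two]))] at h2
    change coeff d h • PowerSeries.coeff n _ = 0
    rw [h2, smul_zero]

theorem subst_taylorMap_of_inverse {Φ G : (Fin 2 → ℂ) → Fin 2 → ℂ} (hΦ : AnalyticAt ℂ Φ 0)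
    (hΦ0 : Φ 0 = 0) (hG : AnalyticAt ℂ G 0)
    (hGΦ : ∀ᶠ z in 𝓝 0, G (Φ z) = z) (i : Fin 2) : subst (taylorMap Φ) (taylorMap G i) = X i := by
  rw [← taylorMap_comp hG hΦ hΦ0]
  have hX : IsConvergent (X i : Series2) := ⟨1, one_pos, by
    have := wnorm_coe_ne_top (r := 1) (MvPolynomial.X i : MvPolynomial (Fin 2) ℂ)
    rwa [MvPolynomial.coe_X] at this⟩
  refine taylorSeries_eq_of_eventuallyEq hX ?_
  filter_upwards [hGΦ] with z hz
  rw [hz, evalSeries, tsum_eq_single (Finsupp.single i 1)]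
  · simp
  · intro m hm
    rw [coeff_X, if_neg hm, zero_mul]

theorem fderiv_comp_of_inverse {Φ G : (Fin 2 → ℂ) → Fin 2 → ℂ} (hΦ : AnalyticAt ℂ Φ 0)
    (hG : AnalyticAt ℂ G 0) (hG0 : G 0 = 0) (hΦG : ∀ᶠ z in 𝓝 0, Φ (G z) = z) (v : Fin 2 → ℂ) :
    fderiv ℂ Φ 0 (fderiv ℂ G 0 v) = v := by
  have h1 : HasFDerivAt (fun z => Φ (G z)) ((fderiv ℂ Φ 0).comp (fderiv ℂ G 0)) 0 := by
    refine HasFDerivAt.comp (0 : Fin 2 → ℂ) ?_ hG.differentiableAt.hasFDerivAt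
    rw [hG0]; exact hΦ.differentiableAt.hasFDerivAt
  have h2 := h1.unique ((hasFDerivAt_id (0 : Fin 2 → ℂ)).congr_of_eventuallyEq hΦG)
  exact congrArg (fun L => L v) h2

variable {Γ : Ideal Series2} {Φ : (Fin 2 → ℂ) → Fin 2 → ℂ} {p q : ℕ}

/-- Because `p < q`, the initial form of `Φ₁ ^ p - Φ₀ ^ q` is the `p`-th power of the linear part of
`Φ₁`. -/
theorem homogeneousPartAt_mul_cusp (hΦ : IsGermDiffeo Φ) (hpq : p < q) (k : Series2)
    (v : Fin 2 → ℂ) :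
    homogeneousPartAt p ((taylorMap Φ 1 ^ p - taylorMap Φ 0 ^ q) * k) v =
      (fderiv ℂ Φ 0 v 1) ^ p * constantCoeff k := by
  have hv0 : ∀ i, constantCoeff (v i • PowerSeries.X : PowerSeries ℂ) = 0 := fun i => by
    change PowerSeries.constantCoeff (v i • PowerSeries.X : PowerSeries ℂ) = 0
    simp [PowerSeries.smul_eq_C_mul]
  have hs : HasSubst fun i => (v i • PowerSeries.X : PowerSeries ℂ) :=
    hasSubst_of_constantCoeff_zero hv0
  let ev : Series2 → PowerSeries ℂ := subst fun i => (v i • PowerSeries.X : PowerSeries ℂ)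
  have hev0 : ∀ h, PowerSeries.constantCoeff (ev h) = constantCoeff h := fun h =>
    constantCoeff_subst_eq hv0 h
  have hT0 : ∀ i, ∀ j < 1, PowerSeries.coeff j (ev (taylorMap Φ i)) = 0 := by
    intro i j hj
    rw [Nat.lt_one_iff.1 hj, PowerSeries.coeff_zero_eq_constantCoeff_apply, hev0, taylorMap,
      constantCoeff_taylorSeries, hΦ.2.1]
    rfl
  have hT1 : ∀ i, PowerSeries.coeff 1 (ev (taylorMap Φ i)) = fderiv ℂ Φ 0 v i := by
    intro i
    rw [fderiv_apply_eq_sum hΦ.1]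
    refine (coeff_single_subst () hv0 (taylorMap Φ i)).trans (Finset.sum_congr rfl fun j _ => ?_)
    change _ * PowerSeries.coeff 1 (v j • PowerSeries.X : PowerSeries ℂ) = _
    rw [PowerSeries.coeff_smul, PowerSeries.coeff_one_X, smul_eq_mul, mul_one, mul_comm]
  obtain ⟨h1, h2⟩ := coeff_pow_of_forall_lt (hT0 1) p
  obtain ⟨h3, -⟩ := coeff_pow_of_forall_lt (hT0 0) q
  rw [one_mul] at h1 h2 h3
  have h4 := (coeff_mul_of_forall_lt (n := p)
    (a := ev (taylorMap Φ 1) ^ p - ev (taylorMap Φ 0) ^ q)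
    (fun j hj => by rw [map_sub, h1 j hj, h3 j (hj.trans hpq), sub_zero]) (ev k)).2
  rw [homogeneousPartAt_eq_coeff]
  have h5 : (subst (fun i => (v i • PowerSeries.X : PowerSeries ℂ))
      ((taylorMap Φ 1 ^ p - taylorMap Φ 0 ^ q) * k) : PowerSeries ℂ) =
      (ev (taylorMap Φ 1) ^ p - ev (taylorMap Φ 0) ^ q) * ev k := by
    rw [subst_mul hs, subst_sub hs, subst_pow hs, subst_pow hs]
  rw [h5, h4, map_sub, h2, h3 p hpq, sub_zero, hT1, hev0]

/-- Composition with `Φ` is an automorphism of `ℂ[[x, y]]`, with inverse given by the inverse germ,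
so it carries a generator of the cusp ideal to one of `Γ`. -/
theorem mem_iff_dvd_of_cusp (hΦ : IsGermDiffeo Φ)
    (hΓ : ∀ h, h ∈ cusp p q ↔ compGerm h Φ ∈ Γ) (h : Series2) :
    h ∈ Γ ↔ taylorMap Φ 1 ^ p - taylorMap Φ 0 ^ q ∣ h := by
  obtain ⟨hΦa, hΦ0, G, hGa, hG0, hGΦ, -⟩ := hΦ
  have hs := hasSubst_taylorMap hΦ0
  have hgen : ∀ k, subst (taylorMap Φ) ((X 1 ^ p - X 0 ^ q : Series2) * k) =
      (taylorMap Φ 1 ^ p - taylorMap Φ 0 ^ q) * subst (taylorMap Φ) k := fun k => by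
    rw [subst_mul hs, subst_sub hs, subst_pow hs, subst_pow hs, subst_X hs, subst_X hs]
  constructor
  · intro hh
    have h1 : subst (taylorMap Φ) (subst (taylorMap G) h) = h := by
      rw [subst_comp_subst_apply (hasSubst_taylorMap hG0) hs]
      have : (fun s => subst (taylorMap Φ) (taylorMap G s)) = X :=
        funext fun i => subst_taylorMap_of_inverse hΦa hΦ0 hGa hGΦ i
      rw [this, subst_self]
      rfl
    have h2 : subst (taylorMap G) h ∈ cusp p q := (hΓ _).2 (by rw [compGerm, h1]; exact hh)
    obtain ⟨k, hk⟩ := Ideal.mem_span_singleton.1 h2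
    rw [hk, hgen] at h1
    exact ⟨_, h1.symm⟩
  · rintro ⟨k, rfl⟩
    refine Γ.mul_mem_right k ?_
    have h1 := (hΓ (X 1 ^ p - X 0 ^ q)).1 (Ideal.subset_span rfl)
    have h2 := hgen 1
    rw [← coe_substAlgHom hs, map_one, mul_one, mul_one, coe_substAlgHom hs] at h2
    rwa [compGerm, h2] at h1

theorem exists_fderiv_ne_zero (hΦ : IsGermDiffeo Φ) (i : Fin 2) :
    ∃ v, fderiv ℂ Φ 0 v = Pi.single i 1 := by
  obtain ⟨hΦa, hΦ0, G, hGa, hG0, -, hΦG⟩ := hΦ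
  exact ⟨_, fderiv_comp_of_inverse hΦa hGa hG0 hΦG _⟩

theorem curveMultiplicity_eq (hΦ : IsGermDiffeo Φ) (hpq : p < q)
    (hΓ : ∀ h, h ∈ cusp p q ↔ compGerm h Φ ∈ Γ) : curveMultiplicity Γ = p := by
  have hmem := mem_iff_dvd_of_cusp hΦ hΓ
  refine le_antisymm ?_ (le_iInf₂ fun h hh => ?_)
  · refine (iInf₂_le _ ((hmem _).2 dvd_rfl)).trans ?_
    -- At this `v` the initial form of the generator has the value `1`, so the generator has a
    -- nonzero coefficient of degree `p`.
    obtain ⟨v, hv⟩ := exists_fderiv_ne_zero hΦ 1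
    have h1 := homogeneousPartAt_mul_cusp hΦ hpq 1 v
    rw [mul_one, hv] at h1
    simp only [Pi.single_eq_same, one_pow, map_one, mul_one] at h1
    obtain ⟨d, hd, hne⟩ := Finset.exists_ne_zero_of_sum_ne_zero
      (h1.symm ▸ one_ne_zero : homogeneousPartAt p _ v ≠ 0)
    have h2 := order_le (left_ne_zero_of_mul hne)
    have h3 : d.degree = p := by
      rw [degree_fin_two, ← (Finset.mem_finsuppAntidiag.1 hd).1, Fin.sum_univ_two]
    rwa [h3] at h2
  · obtain ⟨k, rfl⟩ := (hmem h).1 hh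
    have h0 : ∀ i, constantCoeff (taylorMap Φ i) = 0 := fun i => by
      rw [taylorMap, constantCoeff_taylorSeries, hΦ.2.1]; rfl
    have h1 : (p : ℕ∞) ≤ (taylorMap Φ 1 ^ p - taylorMap Φ 0 ^ q).order := by
      rw [sub_eq_add_neg]
      refine le_trans (le_min (le_order_pow_of_constantCoeff_eq_zero p (h0 1)) ?_) min_order_le_add
      rw [order_neg]
      exact le_trans (by exact_mod_cast hpq.le) (le_order_pow_of_constantCoeff_eq_zero q (h0 0))
    exact (h1.trans le_self_add).trans le_order_mul

theorem mem_tangentLine_iff (hΦ : IsGermDiffeo Φ) (hp : p ≠ 0) (hpq : p < q)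
    (hΓ : ∀ h, h ∈ cusp p q ↔ compGerm h Φ ∈ Γ) (v : Fin 2 → ℂ) :
    v ∈ tangentLine Γ ↔ fderiv ℂ Φ 0 v 1 = 0 := by
  have hmem := mem_iff_dvd_of_cusp hΦ hΓ
  rw [tangentLine, Set.mem_ofPred_eq, curveMultiplicity_eq hΦ hpq hΓ, ENat.toNat_natCast]
  constructor
  · intro h
    have h1 := h _ ((hmem _).2 (dvd_mul_right _ 1))
    rw [homogeneousPartAt_mul_cusp hΦ hpq] at h1
    simpa [hp] using h1
  · intro h g hg
    obtain ⟨k, rfl⟩ := (hmem g).1 hg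
    rw [homogeneousPartAt_mul_cusp hΦ hpq, h, zero_pow hp, zero_mul]

/-- The tangent line is the kernel of `dΦ₁`, which `dΦ` maps onto the first axis, and `dΦ`
conjugates `DF(0)` to the diagonal matrix. -/
theorem isTangentEigenvalue_of_cusp {F : (Fin 2 → ℂ) → Fin 2 → ℂ} (hF : IsGermDiffeo F)
    (hΦ : IsGermDiffeo Φ) (hp : p ≠ 0) (hpq : p < q)
    (hΓ : ∀ h, h ∈ cusp p q ↔ compGerm h Φ ∈ Γ) {Λ : Fin 2 → ℂ}
    (hΦF : ∀ᶠ z in 𝓝 0, ∀ i, Φ (F z) i = Λ i * Φ z i) : IsTangentEigenvalue F Γ (Λ 0) := by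
  have hd : ∀ v i, fderiv ℂ Φ 0 (fderiv ℂ F 0 v) i = Λ i * fderiv ℂ Φ 0 v i := by
    intro v i
    have h1 : HasFDerivAt (fun z => Φ (F z)) ((fderiv ℂ Φ 0).comp (fderiv ℂ F 0)) 0 := by
      refine HasFDerivAt.comp (0 : Fin 2 → ℂ) ?_ hF.1.differentiableAt.hasFDerivAt
      rw [hF.2.1]; exact hΦ.1.differentiableAt.hasFDerivAt
    have h2 := hasFDerivAt_pi'.1 h1 i
    have h3 := (hasFDerivAt_pi'.1 hΦ.1.differentiableAt.hasFDerivAt i).const_mul (Λ i)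
    have h4 := h2.unique (h3.congr_of_eventuallyEq (hΦF.mono fun z hz => hz i))
    exact congrArg (fun L => L v) h4
  refine ⟨?_, fun v hv => ?_⟩
  · obtain ⟨v, hv⟩ := exists_fderiv_ne_zero hΦ 0
    refine ⟨v, (mem_tangentLine_iff hΦ hp hpq hΓ v).2 (by rw [hv]; simp), ?_⟩
    rintro rfl
    rw [map_zero] at hv
    have := congrFun hv 0
    simp at this
  · have h1 := (mem_tangentLine_iff hΦ hp hpq hΓ v).1 hv
    refine sub_eq_zero.1 (hΦ.injective_fderiv ?_)
    ext i
    rw [map_sub, map_smul, Pi.sub_apply, hd]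
    fin_cases i
    · simp
    · simp [h1]

end TangentLine

/-! ### From the linearizing chart to the normal form of the curve. -/

section Uniformization

variable {Γ : Ideal Series2} {γ : Fin 2 → PowerSeries ℂ} {θ : PowerSeries ℂ}

theorem IsParametrization.constantCoeff_eq_zero_of_mem (hγ : IsParametrization Γ γ) {h : Series2}
    (hh : h ∈ Γ) : constantCoeff h = 0 := by
  rw [← constantCoeff_subst_eq hγ.constantCoeff_eq_zero, (hγ.mem_iff h).1 hh, map_zero]

/-- Every element of `Γ` vanishes at the origin, so a nonzero linear coefficient would make the
multiplicity exactly `1`. Singularity enters the argument only in this form. -/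
theorem IsSingular.coeff_single_eq_zero (hsing : IsSingular Γ) (hγ : IsParametrization Γ γ)
    {h : Series2} (hh : h ∈ Γ) (j : Fin 2) : coeff (Finsupp.single j 1) h = 0 := by
  by_contra hne
  refine hsing (le_antisymm ((iInf₂_le h hh).trans ?_) (le_iInf₂ fun g hg => ?_))
  · have := order_le hne
    rwa [Finsupp.degree_single, Nat.cast_one] at this
  · exact one_le_order_iff_constCoeff_eq_zero.2 (hγ.constantCoeff_eq_zero_of_mem hg)

/-- A left eigenvector makes `M - b` singular, hence also yields a right one; eigenvectors for
distinct eigenvalues are independent. -/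
theorem exists_linearIndependent_eigenvectors {M : Fin 2 → Fin 2 → ℂ} {a b : ℂ} (hab : a ≠ b)
    {w u : Fin 2 → ℂ} (hw : w ≠ 0) (hu : u ≠ 0) (hMw : ∀ i, ∑ j, M i j * w j = a * w i)
    (hMu : ∀ j, ∑ i, u i * M i j = b * u j) :
    ∃ w', (∀ i, ∑ j, M i j * w' j = b * w' i) ∧ LinearIndependent ℂ ![w, w'] := by
  have h1 : (Matrix.of M - b • 1).det = 0 := by
    refine Matrix.exists_vecMul_eq_zero_iff.1 ⟨u, hu, ?_⟩
    rw [Matrix.vecMul_sub, Matrix.vecMul_smul, Matrix.vecMul_one, sub_eq_zero]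
    exact funext hMu
  obtain ⟨w', hw', h2⟩ := Matrix.exists_mulVec_eq_zero_iff.2 h1
  rw [Matrix.sub_mulVec, Matrix.smul_mulVec, Matrix.one_mulVec, sub_eq_zero] at h2
  have hMw' : ∀ i, ∑ j, M i j * w' j = b * w' i := fun i => congrFun h2 i
  refine ⟨w', hMw', LinearIndependent.pair_iff.2 fun s t hst => ?_⟩
  have h3 : ∀ i, s * w i + t * w' i = 0 := fun i => congrFun hst i
  have h4 : ∀ i, a * (s * w i) + b * (t * w' i) = 0 := fun i => by
    have h5 := hMw i
    have h6 := hMw' i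
    rw [Fin.sum_univ_two] at h5 h6
    linear_combination M i 0 * h3 0 + M i 1 * h3 1 - s * h5 - t * h6
  have hs : s = 0 := by
    obtain ⟨i, hi⟩ := Function.ne_iff.1 hw
    have h5 : (a - b) * (s * w i) = 0 := by linear_combination h4 i - b * h3 i
    simpa [sub_ne_zero.2 hab, show w i ≠ 0 from hi] using h5
  refine ⟨hs, ?_⟩
  obtain ⟨i, hi⟩ := Function.ne_iff.1 hw'
  have h5 := h3 i
  rw [hs, zero_mul, zero_add] at h5
  exact (mul_eq_zero.1 h5).resolve_right hi

/-- A resonance means `n k + m l = n` or `n k + m l = m` with `k + l ≥ 2`. Size excludes everything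
except `n k = m`, which `¬ n ∣ m` forbids. -/
theorem not_resonant_of_not_dvd {a : ℂ} (ha : Function.Injective fun k : ℕ => a ^ k) {n m : ℕ}
    (hn : 0 < n) (hnm : n < m) (hd : ¬ n ∣ m) (i : Fin 2) (d : Fin 2 →₀ ℕ) (h2 : 2 ≤ d.degree) :
    (d.prod fun j e => (![a ^ n, a ^ m] : Fin 2 → ℂ) j ^ e) ≠ (![a ^ n, a ^ m] : Fin 2 → ℂ) i := by
  rw [degree_fin_two] at h2
  rw [prod_pow_fin_two]
  change (a ^ n) ^ d 0 * (a ^ m) ^ d 1 ≠ _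
  rw [← pow_mul, ← pow_mul, ← pow_add]
  generalize d 0 = k at h2 ⊢
  generalize d 1 = l at h2 ⊢
  fin_cases i
  · intro he
    have h1 : n * k + m * l = n := ha he
    rcases Nat.eq_zero_or_pos l with rfl | hl
    · nlinarith
    · nlinarith
  · intro he
    have h1 : n * k + m * l = m := ha he
    rcases Nat.eq_zero_or_pos l with rfl | hl
    · exact hd ⟨k, by omega⟩
    · rcases Nat.eq_zero_or_pos k with rfl | hk
      · nlinarith
      · nlinarith

theorem powerSeries_subst_zero {τ : PowerSeries ℂ} (hτ : PowerSeries.constantCoeff τ = 0) :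
    PowerSeries.subst τ (0 : PowerSeries ℂ) = (0 : PowerSeries ℂ) := by
  rw [← PowerSeries.coe_substAlgHom (PowerSeries.HasSubst.of_constantCoeff_zero' hτ), map_zero]

theorem powerSeries_subst_eq_zero_iff {τ g : PowerSeries ℂ}
    (hτ : PowerSeries.constantCoeff τ = 0) (hτ0 : τ ≠ 0) :
    PowerSeries.subst τ g = (0 : PowerSeries ℂ) ↔ g = 0 := by
  refine ⟨fun h => ?_, fun h => h ▸ powerSeries_subst_zero hτ⟩
  by_contra hg
  obtain ⟨n, hn, hnlt⟩ := exists_coeff_ne_zero_forall_lt hτ0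
  obtain ⟨j, hj, hjlt⟩ := exists_coeff_ne_zero_forall_lt hg
  have hn0 : 0 < n := Nat.pos_of_ne_zero fun h0 => hn (by
    rw [h0, PowerSeries.coeff_zero_eq_constantCoeff_apply, hτ])
  have h1 := (coeff_subst_of_forall_lt hn0 hnlt hjlt).2
  rw [h, map_zero] at h1
  exact mul_ne_zero hj (pow_ne_zero _ hn) h1.symm

theorem taylorSeries_const_mul {f : (Fin 2 → ℂ) → ℂ} (hf : AnalyticAt ℂ f 0) (c : ℂ) :
    taylorSeries (fun z => c * f z) = c • taylorSeries f := by
  obtain ⟨r, hr, hc⟩ := isConvergent_taylorSeries hf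
  refine taylorSeries_eq_of_eventuallyEq ⟨r, hr, ?_⟩ ?_
  · rw [wnorm_smul]
    exact ENNReal.mul_ne_top (by simp) hc
  · filter_upwards [eventuallyEq_evalSeries_taylorSeries hf] with z hz
    rw [evalSeries_smul, hz]

variable {F Φ : (Fin 2 → ℂ) → Fin 2 → ℂ}

theorem constantCoeff_taylorMap (h0 : Φ 0 = 0) (i : Fin 2) :
    constantCoeff (taylorMap Φ i) = 0 := by
  rw [taylorMap, constantCoeff_taylorSeries, h0]
  rfl

/-- A linearizing chart of `F`, restricted to an invariant parametrized curve, consists of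
eigenfunctions of the restriction of `F` to the curve. -/
theorem subst_subst_taylorMap_of_linearization (hF : IsGermDiffeo F) (hΦ : IsGermDiffeo Φ)
    {Λ : Fin 2 → ℂ} (hΦF : ∀ᶠ z in 𝓝 0, ∀ i, Φ (F z) i = Λ i * Φ z i)
    (hγ0 : ∀ i, PowerSeries.constantCoeff (γ i) = 0) (hθ0 : PowerSeries.constantCoeff θ = 0)
    (hFγ : ∀ i, subst γ (taylorMap F i) = PowerSeries.subst θ (γ i)) (i : Fin 2) :
    PowerSeries.subst θ (subst γ (taylorMap Φ i) : PowerSeries ℂ) =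
      Λ i • (subst γ (taylorMap Φ i) : PowerSeries ℂ) := by
  have hs : HasSubst γ := hasSubst_of_constantCoeff_zero hγ0
  have hΦi := analyticAt_component hΦ.1 i
  have h1 : taylorMap (fun z => Φ (F z)) i = Λ i • taylorMap Φ i := by
    exact (taylorSeries_congr (analyticAt_const.mul hΦi) (hΦF.mono fun z hz => hz i)).trans
      (taylorSeries_const_mul hΦi (Λ i))
  rw [taylorMap_comp hΦ.1 hF.1 hF.2.1] at h1
  rw [powerSeries_subst_subst_left hγ0 hθ0, ← subst_smul hs, ← h1,
    subst_comp_subst_apply (hasSubst_taylorMap hF.2.1) hs]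
  simp only [hFγ]

theorem IsGermDiffeo.const_mul (hΦ : IsGermDiffeo Φ) {c : Fin 2 → ℂ} (hc : ∀ i, c i ≠ 0) :
    IsGermDiffeo fun z i => c i * Φ z i := by
  have h1 : AnalyticAt ℂ (fun z i => c i * Φ z i) 0 :=
    AnalyticAt.pi fun i => analyticAt_const.mul (analyticAt_component hΦ.1 i)
  refine isGermDiffeo_of_injective_fderiv h1 ?_ fun v hv => ?_
  · simp [hΦ.2.1]
    rfl
  · refine hΦ.injective_fderiv (funext fun i => ?_)
    have h2 := (hasFDerivAt_pi'.1 hΦ.1.differentiableAt.hasFDerivAt i).const_mul (c i)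
    have h3 := (hasFDerivAt_pi'.1 h1.differentiableAt.hasFDerivAt i).unique h2
    have h4 := congrArg (fun L => L v) h3
    change fderiv ℂ (fun z i => c i * Φ z i) 0 v i = c i * fderiv ℂ Φ 0 v i at h4
    rw [hv] at h4
    exact (mul_eq_zero.1 h4.symm).resolve_left (hc i)

theorem IsGermDiffeo.exists_coeff_single_ne_zero (hΦ : IsGermDiffeo Φ) (i : Fin 2) :
    ∃ j, coeff (Finsupp.single j 1) (taylorMap Φ i) ≠ 0 := by
  by_contra! h
  obtain ⟨v, hv⟩ := exists_fderiv_ne_zero hΦ i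
  have h1 := fderiv_apply_eq_sum hΦ.1 v i
  rw [hv] at h1
  simp [h] at h1

/-- Around a singular hyperbolic curve there is a linearizing chart in which an irreducible
parametrization of the curve is `(φ ^ n, φ ^ m)` for a series `φ` of order one. -/
theorem exists_linearization_of_singular (hF : IsGermDiffeo F) (hγ : IsParametrization Γ γ)
    (hsing : IsSingular Γ) (hθ0 : PowerSeries.constantCoeff θ = 0)
    (hθ1 : PowerSeries.coeff 1 θ ≠ 0) (hθ : ‖PowerSeries.coeff 1 θ‖ ≠ 1)
    (hFγ : ∀ i, subst γ (taylorMap F i) = PowerSeries.subst θ (γ i)) :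
    ∃ n m, 0 < n ∧ n < m ∧ ¬ n ∣ m ∧ ∃ Φ, IsGermDiffeo Φ ∧
      (∀ᶠ z in 𝓝 0, ∀ i, Φ (F z) i =
        (![PowerSeries.coeff 1 θ ^ n, PowerSeries.coeff 1 θ ^ m] : Fin 2 → ℂ) i * Φ z i) ∧
      ∃ φ : PowerSeries ℂ, PowerSeries.constantCoeff φ = 0 ∧ PowerSeries.coeff 1 φ = 1 ∧
        ∀ i, (subst γ (taylorMap Φ i) : PowerSeries ℂ) = (![φ ^ n, φ ^ m] : Fin 2 → _) i := by
  set a := PowerSeries.coeff 1 θ with ha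
  have hγ0 := hγ.constantCoeff_eq_zero
  have hs : HasSubst γ := hasSubst_of_constantCoeff_zero hγ0
  have hsing' : ∀ h : Series2, subst γ h = 0 → ∀ j, coeff (Finsupp.single j 1) h = 0 :=
    fun h hh j => hsing.coeff_single_eq_zero hγ ((hγ.mem_iff h).2 hh) j
  have hinj : Function.Injective fun k : ℕ => a ^ k := by
    intro k l hkl
    have h1 := congrArg norm hkl
    simp only [norm_pow] at h1
    exact pow_right_injective₀ (norm_pos_iff.2 hθ1) hθ h1
  obtain ⟨n, m, hn, hnm, hd, w, u, hw, hu, hMw, hMu⟩ :=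
    exists_eigenvectors (constantCoeff_taylorMap hF.2.1) hγ0 hθ0 hFγ hsing'
  obtain ⟨w', hMw', hli⟩ :=
    exists_linearIndependent_eigenvectors (fun h => hnm.ne (hinj h)) hw hu hMw hMu
  have hlin : ∀ (v : Fin 2 → ℂ) (b : ℂ),
      (∀ i, ∑ j, coeff (Finsupp.single j 1) (taylorMap F i) * v j = b * v i) →
        fderiv ℂ F 0 v = b • v := by
    intro v b hv
    ext i
    rw [fderiv_apply_eq_sum hF.1, Pi.smul_apply, smul_eq_mul, ← hv]
    exact Finset.sum_congr rfl fun j _ => mul_comm _ _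
  have hΛ : (∀ i, ‖(![a ^ n, a ^ m] : Fin 2 → ℂ) i‖ < 1) ∨
      ∀ i, 1 < ‖(![a ^ n, a ^ m] : Fin 2 → ℂ) i‖ := by
    rcases lt_or_gt_of_ne hθ with h | h
    · left
      rw [Fin.forall_fin_two]
      constructor
      · simpa using pow_lt_one₀ (norm_nonneg _) h hn.ne'
      · simpa using pow_lt_one₀ (norm_nonneg _) h (hn.trans hnm).ne'
    · right
      rw [Fin.forall_fin_two]
      constructor
      · simpa using one_lt_pow₀ h hn.ne'
      · simpa using one_lt_pow₀ h (hn.trans hnm).ne'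
  obtain ⟨Φ, hΦ, hΦF⟩ := exists_linearization hF (Λ := ![a ^ n, a ^ m]) hli
    (Fin.forall_fin_two.2 ⟨hlin w _ hMw, hlin w' _ hMw'⟩) hΛ
    (not_resonant_of_not_dvd hinj hn hnm hd)
  have hΦθ := subst_subst_taylorMap_of_linearization hF hΦ hΦF hγ0 hθ0 hFγ
  obtain ⟨φ, hφ0, hφ1, hφ⟩ := exists_formal_linearization hθ0 hinj
  have hexp : ∃ c : Fin 2 → ℂ, ∀ i, (subst γ (taylorMap Φ i) : PowerSeries ℂ) =
      c i • (![φ ^ n, φ ^ m] : Fin 2 → _) i :=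
    ⟨![_, _], Fin.forall_fin_two.2
      ⟨eq_smul_pow_of_subst_eq_smul hθ0 hinj hφ0 hφ1 hφ (hΦθ 0),
        eq_smul_pow_of_subst_eq_smul hθ0 hinj hφ0 hφ1 hφ (hΦθ 1)⟩⟩
  obtain ⟨c, hc⟩ := hexp
  -- If `c i` were zero, the component `Φ i` would vanish on the singular curve, although its linear
  -- part is nonzero.
  have hc0 : ∀ i, c i ≠ 0 := by
    intro i hi
    obtain ⟨j, hj⟩ := hΦ.exists_coeff_single_ne_zero i
    exact hj (hsing' _ (by rw [hc, hi, zero_smul]) j)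
  refine ⟨n, m, hn, hnm, hd, _, hΦ.const_mul fun i => inv_ne_zero (hc0 i), ?_, φ, hφ0, hφ1,
    fun i => ?_⟩
  · filter_upwards [hΦF] with z hz i
    rw [hz i, mul_left_comm]
  · have h1 : taylorMap (fun z i => (c i)⁻¹ * Φ z i) i = (c i)⁻¹ • taylorMap Φ i :=
      taylorSeries_const_mul (analyticAt_component hΦ.1 i) _
    rw [h1, subst_smul hs, hc, inv_smul_smul₀ (hc0 i)]

theorem powerSeries_subst_subst_X_pow {τ : PowerSeries ℂ} (hτ : PowerSeries.constantCoeff τ = 0)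
    {p q : ℕ} (hp : 0 < p) (hq : 0 < q) (h : Series2) :
    PowerSeries.subst τ
      (subst ![(PowerSeries.X ^ p : PowerSeries ℂ), PowerSeries.X ^ q] h : PowerSeries ℂ) =
      (subst ![τ ^ p, τ ^ q] h : PowerSeries ℂ) := by
  have hs : PowerSeries.HasSubst τ := PowerSeries.HasSubst.of_constantCoeff_zero' hτ
  rw [powerSeries_subst_subst_left (Fin.forall_fin_two.2 ⟨by simp [hp.ne'], by simp [hq.ne']⟩) hτ]
  congr 1
  ext1 i
  fin_cases i
  · change PowerSeries.subst τ (PowerSeries.X ^ p) = τ ^ p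
    rw [PowerSeries.subst_pow hs, PowerSeries.subst_X hs]
  · change PowerSeries.subst τ (PowerSeries.X ^ q) = τ ^ q
    rw [PowerSeries.subst_pow hs, PowerSeries.subst_X hs]

/-- With a common divisor `g > 1`, `γ` would factor through `τ = φ ^ g` and `σ = Φ⁻¹(s ^ p, s ^ q)`,
where `p = n / g` and `q = m / g`. Substituting the nonzero `τ` is injective, so `σ` parametrizes
the same ideal, while `τ` has no linear term. -/
theorem IsIrreducibleParametrization.coprime (hγ : IsIrreducibleParametrization Γ γ)
    (hΦ : IsGermDiffeo Φ) {n m : ℕ} (hn : 0 < n) (hm : 0 < m) {φ : PowerSeries ℂ}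
    (hφ0 : PowerSeries.constantCoeff φ = 0) (hφ1 : PowerSeries.coeff 1 φ = 1)
    (hφ : ∀ i, (subst γ (taylorMap Φ i) : PowerSeries ℂ) = (![φ ^ n, φ ^ m] : Fin 2 → _) i) :
    n.Coprime m := by
  obtain ⟨hΦa, hΦ0, G, hGa, hG0, hGΦ, -⟩ := hΦ
  have hs : HasSubst γ := hasSubst_of_constantCoeff_zero hγ.constantCoeff_eq_zero
  obtain ⟨p, hp⟩ := Nat.gcd_dvd_left n m
  obtain ⟨q, hq⟩ := Nat.gcd_dvd_right n m
  have hg : 0 < n.gcd m := Nat.gcd_pos_of_pos_left m hn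
  rw [Nat.Coprime]
  generalize n.gcd m = g at hp hq hg
  subst hp hq
  have hp := Nat.pos_of_mul_pos_left hn
  have hq := Nat.pos_of_mul_pos_left hm
  by_contra hg1
  set τ := φ ^ g with hτ
  have hτ0 : PowerSeries.constantCoeff τ = 0 := by rw [hτ, map_pow, hφ0, zero_pow hg.ne']
  have hφlt : ∀ k < 1, PowerSeries.coeff k φ = 0 := fun k hk => by
    rw [Nat.lt_one_iff.1 hk, PowerSeries.coeff_zero_eq_constantCoeff_apply, hφ0]
  have hτne : τ ≠ 0 := by
    refine pow_ne_zero _ ?_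
    rintro rfl
    simp at hφ1
  have hcusp : ∀ i, PowerSeries.constantCoeff
      ((![PowerSeries.X ^ p, PowerSeries.X ^ q] : Fin 2 → PowerSeries ℂ) i) = 0 :=
    Fin.forall_fin_two.2 ⟨by simp [hp.ne'], by simp [hq.ne']⟩
  let σ : Fin 2 → PowerSeries ℂ := fun i => subst ![PowerSeries.X ^ p, PowerSeries.X ^ q]
    (taylorMap G i)
  have hσ0 : ∀ i, PowerSeries.constantCoeff (σ i) = 0 := fun i =>
    (constantCoeff_subst_eq hcusp _).trans (constantCoeff_taylorMap hG0 i)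
  have hσ : ∀ i, γ i = PowerSeries.subst τ (σ i) := by
    intro i
    have h1 : (fun i => (subst γ (taylorMap Φ i) : PowerSeries ℂ)) = ![τ ^ p, τ ^ q] := by
      rw [hτ, ← pow_mul, ← pow_mul]
      exact funext hφ
    rw [powerSeries_subst_subst_X_pow hτ0 hp hq, ← h1,
      ← subst_comp_subst_apply (hasSubst_taylorMap hΦ0) hs,
      subst_taylorMap_of_inverse hΦa hΦ0 hGa hGΦ, subst_X hs]
  have hmem : ∀ h : Series2, (subst γ h : PowerSeries ℂ) = PowerSeries.subst τ (subst σ h) := by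
    intro h
    rw [powerSeries_subst_subst_left hσ0 hτ0]
    congr 1
    exact funext hσ
  refine hγ.irreducible σ τ ⟨?_, hσ0, fun h => ?_⟩ hτ0 hσ ?_
  · intro h0
    refine hγ.ne_zero (funext fun i => ?_)
    rw [hσ, h0]
    exact powerSeries_subst_zero hτ0
  · rw [hγ.mem_iff, hmem]
    exact powerSeries_subst_eq_zero_iff hτ0 hτne
  · exact (coeff_pow_of_forall_lt hφlt g).1 1 (by omega)

/-- Along `γ`, the series `h ∘ Φ` is `h(s ^ n, s ^ m)` evaluated at `s = φ`, and substituting the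
nonzero series `φ` is injective. -/
theorem IsParametrization.mem_cusp_iff (hγ : IsParametrization Γ γ) (hΦ0 : Φ 0 = 0) {n m : ℕ}
    (hn : 0 < n) (hm : 0 < m) (hnm : n.Coprime m) {φ : PowerSeries ℂ}
    (hφ0 : PowerSeries.constantCoeff φ = 0) (hφ1 : PowerSeries.coeff 1 φ = 1)
    (hφ : ∀ i, (subst γ (taylorMap Φ i) : PowerSeries ℂ) = (![φ ^ n, φ ^ m] : Fin 2 → _) i)
    (h : Series2) : h ∈ cusp n m ↔ compGerm h Φ ∈ Γ := by
  have hφne : φ ≠ 0 := by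
    rintro rfl
    simp at hφ1
  have h1 : (subst γ (compGerm h Φ) : PowerSeries ℂ) = PowerSeries.subst φ
      (subst ![(PowerSeries.X ^ n : PowerSeries ℂ), PowerSeries.X ^ m] h : PowerSeries ℂ) := by
    rw [powerSeries_subst_subst_X_pow hφ0 hn hm, compGerm,
      subst_comp_subst_apply (hasSubst_taylorMap hΦ0)
        (hasSubst_of_constantCoeff_zero hγ.constantCoeff_eq_zero)]
    congr 1
    exact funext hφ
  rw [PlanarCurve.mem_cusp_iff hn hm hnm, hγ.mem_iff, h1]
  exact (powerSeries_subst_eq_zero_iff hφ0 hφne).symm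

end Uniformization

end PlanarCurve

theorem mainTheorem8 (F : (Fin 2 → ℂ) → (Fin 2 → ℂ)) (hF : PlanarCurve.IsGermDiffeo F)
    (Γ : Ideal PlanarCurve.Series2) (hΓ : PlanarCurve.IsFormalCurve Γ)
    (hinv : PlanarCurve.IsInvariant F Γ) (hhyp : PlanarCurve.IsHyperbolic F Γ)
    (hsing : PlanarCurve.IsSingular Γ) :
    ∃ (p q : ℕ) (lam μ : ℂ), 1 < p ∧ p < q ∧ Nat.Coprime p q ∧
      PlanarCurve.IsTangentEigenvalue F Γ lam ∧ lam ^ q = μ ^ p ∧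
      ∃ Φ : (Fin 2 → ℂ) → (Fin 2 → ℂ), PlanarCurve.IsGermDiffeo Φ ∧
        (∀ᶠ z in 𝓝 0, Φ (F z) = ![lam * Φ z 0, μ * Φ z 1]) ∧
        ∀ h : PlanarCurve.Series2,
          h ∈ PlanarCurve.cusp p q ↔ PlanarCurve.compGerm h Φ ∈ Γ := by
  obtain ⟨θ, ⟨hθ0, hθ1, γ, hγ, hFγ⟩, hθ⟩ := hhyp
  have hγ' := hγ.toIsParametrization
  obtain ⟨n, m, hn, hnm, hd, Φ, hΦ, hΦF, φ, hφ0, hφ1, hφ⟩ :=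
    PlanarCurve.exists_linearization_of_singular hF hγ' hsing hθ0 hθ1 hθ hFγ
  have hcop := hγ.coprime hΦ hn (hn.trans hnm) hφ0 hφ1 hφ
  have hcusp := hγ'.mem_cusp_iff hΦ.2.1 hn (hn.trans hnm) hcop hφ0 hφ1 hφ
  refine ⟨n, m, PowerSeries.coeff 1 θ ^ n, PowerSeries.coeff 1 θ ^ m, ?_, hnm, hcop,
    PlanarCurve.isTangentEigenvalue_of_cusp hF hΦ hn.ne' hnm hcusp hΦF, ?_, Φ, hΦ, ?_, hcusp⟩
  -- The exponent `n` cannot be `1`, which would divide `m`.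
  · refine lt_of_le_of_ne hn fun h => hd (h ▸ one_dvd m)
  · rw [← pow_mul, ← pow_mul, mul_comm]
  · filter_upwards [hΦF] with z hz
    exact funext (Fin.forall_fin_two.2 ⟨hz 0, hz 1⟩)
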